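/- **Model.** Let $\Phi_v$ be a homogeneous Poisson point process in $\mathbb R^2$ of density $\lambda>0$ (the UAVs, all at altitude $h_v$), seen from its typical point $v_0$, which is put at the origin (Palm distribution). Every $v\in\Phi_v$ is the centre of a cluster of users at altitude $h_u$. The cluster sizes are i.i.d.; given the centres and the sizes, the users of the cluster at $v$ are at $u=v+y$ with independent displacements $y$, either of density $\frac1{2\pi\sigma^2}e^{-\|y\|^2/(2\sigma^2)}$ (Thomas, $\sigma>0$) or uniform in the disc of radius $R>0$ (Matérn). Put $\Delta h=|h_u-h_v|$ and $\gamma(r)=\lfloor r\sqrt{\beta_a\beta_b}\rfloor$ with $\beta_a,\beta_b>0$. Given its position $u$, the link from a user to $v_0$ is in line of sight (state $L$) with probability $p_L(\gamma(\|u\|))$, and otherwise not (state $N$, probability $p_N=1-p_L$), where for $\varepsilon>0$ $$p_L(\gamma)=\prod_{n=0}^{\gamma}\Big(1-\exp\Big(-\frac{(\gamma\max(h_u,h_v)-(n+\frac12)\Delta h)^2}{2\varepsilon^2\gamma^2}\Big)\Big)\quad(\gamma\ge1),\qquad p_L(0)=1 .$$ In state $\kappa\in\{L,N\}$ the channel gain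 is $H=C_\kappa\,(\|u\|^2+\Delta h^2)^{-\alpha_\kappa/2}\,G\,|\hat h|^2$, with $C_\kappa,\alpha_\kappa>0$, where $|\hat h|^2$ is Gamma distributed with shape $\mathcal N_\kappa>0$ and mean $1$, and $G$ takes the values $$(o_1,o_2,o_3,o_4)=(M_tM_r,\;m_tM_r,\;M_tm_r,\;m_tm_r)$$ with probabilities $$(p_1,p_2,p_3,p_4)=(ab,\;(1-a)b,\;a(1-b),\;(1-a)(1-b)),\qquad a=\tfrac{\theta^a_t}{2\pi}\tfrac{\theta^e_t}{\pi},\quad b=\tfrac{\theta^a_r}{2\pi}\tfrac{\theta^e_r}{\pi},$$ for gains $M_t,m_t,M_r,m_r\ge0$ and beamwidths $\theta^a_t,\theta^a_r\in[0,2\pi]$, $\theta^e_t,\theta^e_r\in[0,\pi]$. All these random choices are independent. Let $\mathbb U_v$ be the set of users of the cluster at $v$. The inter-cluster interference and its Laplace transform are $$I=\sum_{v\in\Phi_v\setminus v_0}\ \sum_{u\in\mathbb U_v}H_u\in[0,\infty],\qquad \mathcal L_e(s)=\mathbb E[e^{-sI}],\quad s\ge0.$$ **Statement.** For $g,q>0$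 let $$f(g|q)=\frac g{\sigma^2}\exp\Big(-\frac{g^2+q^2}{2\sigma^2}\Big)I_0\Big(\frac{gq}{\sigma^2}\Big)$$ in the Thomas case, with $I_0$ the modified Bessel function of the first kind of order zero, and $$f(g|q)=\frac{2g}{\pi R^2}\arccos\Big(\frac{g^2+q^2-R^2}{2gq}\Big)\mathbf 1_{\{|R-q|\le g\le R+q\}}+\frac{2g}{R^2}\mathbf 1_{\{g\le R-q\}}$$ in the Matérn case. For $\kappa\in\{L,N\}$ and $\gamma_1=\gamma(g)$ let $$\Lambda^\kappa(g,s)=p_\kappa(\gamma_1)\sum_{i=1}^4p_i\Big(1+\frac{s\,C_\kappa o_i}{\mathcal N_\kappa (g^2+\Delta h^2)^{\alpha_\kappa/2}}\Big)^{-\mathcal N_\kappa},$$ $$O_e(s,q)=\sum_{\gamma_1=0}^\infty\int_{\gamma_1/\sqrt{\beta_a\beta_b}}^{(\gamma_1+1)/\sqrt{\beta_a\beta_b}}\big(\Lambda^L(g,s)+\Lambda^N(g,s)\big)f(g|q)\,dg .$$ Then, for every $s\ge0$: 1. if every cluster has exactly $\bar N\in\mathbb N$ users, $$\mathcal L_e(s)=\exp\Big(-2\pi\lambda\int_0^\infty\big(1-O_e(s,q)^{\bar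 N}\big)\,q\,dq\Big);$$ 2. if the number of users in each cluster is Poisson distributed with mean $\bar n\ge0$, $$\mathcal L_e(s)=\exp\Big(-2\pi\lambda\int_0^\infty\big(1-e^{-\bar n(1-O_e(s,q))}\big)\,q\,dq\Big).$$ (If the integral is infinite, the right-hand side is $0$; likewise $e^{-sI}=0$ where $I=\infty$ and $s>0$, while for $s=0$ it is $1$.) -/

import Mathlib

open MeasureTheory ProbabilityTheory Set
open scoped ENNReal NNReal Nat

noncomputable section

/-- The horizontal plane with its Euclidean norm and Lebesgue measure. -/
abbrev Plane : Type := EuclideanSpace ℝ (Fin 2)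

/-- `exp (-x)` for `x ∈ [0, ∞]`, with `exp (-∞) = 0`. -/
def expNeg (x : ℝ≥0∞) : ℝ := if x = ∞ then 0 else Real.exp (-x.toReal)

/-! ### Point configurations, Poisson point configurations, Palm versions -/

section PointConfigurations

variable {Ω Ω₀ : Type*} [MeasurableSpace Ω] [MeasurableSpace Ω₀]

/-- The counting measure `∑ₙ δ_{Xₙ}` of the random points `X 0, X 1, …`. -/
def config (X : ℕ → Ω → Plane) (ω : Ω) : Measure Plane :=
  Measure.sum fun n => Measure.dirac (X n ω)

/-- The random points `X 0, X 1, …` (in any order) form a homogeneous Poisson point configuration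
of density `lam` in the plane: the number of points in a Borel set of finite area is Poisson with
mean `lam * area`, and the numbers of points in disjoint Borel sets are independent.
(For `lam > 0` there are infinitely many points, so an enumeration by `ℕ` loses nothing.) -/
structure IsHomogeneousPPP (lam : ℝ) (X : ℕ → Ω → Plane) (P : Measure Ω) : Prop where
  measurable : ∀ n, Measurable (X n)
  count_law : ∀ A : Set Plane, MeasurableSet A → volume A ≠ ∞ →
    HasLaw (fun ω => config X ω A)
      ((poissonMeasure (lam * (volume A).toReal).toNNReal).map (fun k : ℕ => (k : ℝ≥0∞))) P
  count_indep : ∀ (k : ℕ) (A : Fin k → Set Plane), (∀ i, MeasurableSet (A i)) →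
    Pairwise (fun i j => Disjoint (A i) (A j)) →
    iIndepFun (fun i ω => config X ω (A i)) P

/-- `X` (under `P`) is the configuration `Φ` (under `P₀`, stationary of density `lam`) seen from
its typical point, which is put at the origin and listed first: `X 0 = 0`, and the law of the
configuration of `X` is the Palm distribution of `Φ`, that is
`E₀ #{x ∈ Φ ∩ B : Φ - x ∈ 𝒜} = lam * area B * P(X ∈ 𝒜)`
for every Borel set `B` and every measurable set `𝒜` of configurations. -/
structure IsPalmVersion (lam : ℝ) (Φ : ℕ → Ω₀ → Plane) (P₀ : Measure Ω₀)
    (X : ℕ → Ω → Plane) (P : Measure Ω) : Prop where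
  measurable : ∀ n, Measurable (X n)
  typical_at_origin : ∀ᵐ ω ∂P, X 0 ω = 0
  palm : ∀ (B : Set Plane) (𝒜 : Set (Measure Plane)), MeasurableSet B → MeasurableSet 𝒜 →
    ∫⁻ ω, ∑' n, {ω' | Φ n ω' ∈ B ∧ config (fun m ω'' => Φ m ω'' - Φ n ω'') ω' ∈ 𝒜}.indicator
        (fun _ => (1 : ℝ≥0∞)) ω ∂P₀
      = ENNReal.ofReal lam * volume B * P {ω | config X ω ∈ 𝒜}

end PointConfigurations

/-! ### Cluster shapes: Thomas and Matérn -/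

/-- The unit step function. -/
def unitStep (x : ℝ) : ℝ := if 0 ≤ x then 1 else 0

/-- The two cluster shapes: Thomas with standard deviation `σ`, Matérn with radius `R`. -/
inductive ClusterShape where
  | thomas (σ : ℝ)
  | matern (R : ℝ)

namespace ClusterShape

/-- The scale parameter (standard deviation, respectively radius). -/
def scale : ClusterShape → ℝ
  | thomas σ => σ
  | matern R => R

/-- The density in the plane of the position of a user at `u` in a cluster centred at `v`. -/
def density (c : ClusterShape) (u v : Plane) : ℝ :=
  match c with
  | thomas σ => 1 / (2 * Real.pi * σ ^ 2) * Real.exp (-(‖u - v‖ ^ 2 / (2 * σ ^ 2)))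
  | matern R => 1 / (Real.pi * R ^ 2) * unitStep (R - ‖u - v‖)

/-- The law of the displacement `u - v` of a user from its cluster centre. -/
def offsetLaw (c : ClusterShape) : Measure Plane :=
  volume.withDensity fun y => ENNReal.ofReal (c.density y 0)

end ClusterShape

/-- The modified Bessel function of the first kind of order zero. -/
def besselI0 (x : ℝ) : ℝ := ∑' k : ℕ, (x / 2) ^ (2 * k) / ((k ! : ℝ)) ^ 2

/-- The density, at `g`, of the distance from the origin of a user whose cluster centre is at
distance `q` from the origin. -/
def ClusterShape.distDensity (c : ClusterShape) (g q : ℝ) : ℝ :=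
  match c with
  | .thomas σ =>
      g / σ ^ 2 * Real.exp (-((g ^ 2 + q ^ 2) / (2 * σ ^ 2))) * besselI0 (g * q / σ ^ 2)
  | .matern R =>
      2 * g / (Real.pi * R ^ 2) * Real.arccos ((g ^ 2 + q ^ 2 - R ^ 2) / (2 * g * q))
          * unitStep (g - |R - q|) * unitStep (R + q - g)
        + 2 * g / R ^ 2 * unitStep (R - q - g)

/-! ### Channel: blockage, path loss, antenna gain, fading -/

/-- Line-of-sight and non-line-of-sight links. -/
inductive LinkState where
  | los
  | nlos

/-- The deterministic parameters of the uplink. -/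
structure UplinkParams where
  /-- density of the cluster centres (UAVs) -/
  lam : ℝ
  /-- shape of the clusters -/
  shape : ClusterShape
  /-- altitude of the users -/
  hu : ℝ
  /-- altitude of the UAVs -/
  hv : ℝ
  /-- ratio of the obstacle area to the total area -/
  βa : ℝ
  /-- density of the obstacles -/
  βb : ℝ
  /-- scale of the Rayleigh distributed obstacle heights -/
  ε : ℝ
  /-- path loss intercepts -/
  C : LinkState → ℝ
  /-- path loss exponents -/
  α : LinkState → ℝ
  /-- Nakagami fading parameters -/
  nak : LinkState → ℝ
  /-- azimuth and elevation beamwidths of the transmitter (user) -/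
  θta : ℝ
  θte : ℝ
  /-- azimuth and elevation beamwidths of the receiver (UAV) -/
  θra : ℝ
  θre : ℝ
  /-- main lobe and side lobe gains of the transmitter (user) -/
  Mt : ℝ
  mt : ℝ
  /-- main lobe and side lobe gains of the receiver (UAV) -/
  Mr : ℝ
  mr : ℝ

namespace UplinkParams

/-- The physical ranges of the parameters. -/
structure Admissible (p : UplinkParams) : Prop where
  lam_pos : 0 < p.lam
  scale_pos : 0 < p.shape.scale
  βa_pos : 0 < p.βa
  βb_pos : 0 < p.βb
  ε_pos : 0 < p.ε
  C_pos : ∀ κ, 0 < p.C κ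
  α_pos : ∀ κ, 0 < p.α κ
  nak_pos : ∀ κ, 0 < p.nak κ
  θta_mem : p.θta ∈ Icc 0 (2 * Real.pi)
  θte_mem : p.θte ∈ Icc 0 Real.pi
  θra_mem : p.θra ∈ Icc 0 (2 * Real.pi)
  θre_mem : p.θre ∈ Icc 0 Real.pi
  Mt_nonneg : 0 ≤ p.Mt
  mt_nonneg : 0 ≤ p.mt
  Mr_nonneg : 0 ≤ p.Mr
  mr_nonneg : 0 ≤ p.mr

variable (p : UplinkParams)

/-- `Δh`, the difference of the altitudes. -/
def Δh : ℝ := |p.hu - p.hv|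

/-- `√(βa βb)`. -/
def rootβ : ℝ := Real.sqrt (p.βa * p.βb)

/-- `γ(r) = ⌊r √(βa βb)⌋`. -/
def γ (r : ℝ) : ℕ := ⌊r * p.rootβ⌋₊

/-- The probability of a line-of-sight link as a function of `γ`. For `γ = 0` the quotient in the
exponent has denominator zero and is read as `+∞`, so that the link is in line of sight. -/
def probLos (γ : ℕ) : ℝ :=
  if γ = 0 then 1 else
    ∏ n ∈ Finset.range (γ + 1),
      (1 - Real.exp (-(((γ : ℝ) * max p.hu p.hv - ((n : ℝ) + 1 / 2) * p.Δh) ^ 2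
        / (2 * p.ε ^ 2 * (γ : ℝ) ^ 2))))

/-- The probability of a link in state `κ`. -/
def prob (κ : LinkState) (γ : ℕ) : ℝ :=
  match κ with
  | .los => p.probLos γ
  | .nlos => 1 - p.probLos γ

/-- The path loss of a link in state `κ` at horizontal distance `r`. -/
def pathLoss (κ : LinkState) (r : ℝ) : ℝ :=
  p.C κ / Real.sqrt ((r ^ 2 + p.Δh ^ 2) ^ p.α κ)

/-- The four possible values of the directivity gain. -/
def gainValue : Fin 4 → ℝ :=
  ![p.Mt * p.Mr, p.mt * p.Mr, p.Mt * p.mr, p.mt * p.mr]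

/-- The probabilities of the four values of the directivity gain. -/
def gainProb : Fin 4 → ℝ :=
  let a := p.θta / (2 * Real.pi) * (p.θte / Real.pi)
  let b := p.θra / (2 * Real.pi) * (p.θre / Real.pi)
  ![a * b, (1 - a) * b, a * (1 - b), (1 - a) * (1 - b)]

/-- The law of the directivity gain of an interferer. -/
def gainLaw : Measure ℝ :=
  ∑ i : Fin 4, ENNReal.ofReal (p.gainProb i) • Measure.dirac (p.gainValue i)

/-- The joint law of everything attached to one user: displacement from the cluster centre,
uniform variable deciding about blockage, normalized Gamma power fading of a line-of-sight link and
of a non-line-of-sight link, directivity gain; all independent. -/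
def userLaw : Measure (Plane × ℝ × ℝ × ℝ × ℝ) :=
  p.shape.offsetLaw.prod ((volume.restrict (Icc (0 : ℝ) 1)).prod
    ((gammaMeasure (p.nak .los) (p.nak .los)).prod
      ((gammaMeasure (p.nak .nlos) (p.nak .nlos)).prod p.gainLaw)))

/-- `Λ^κ(g, s)`, where `γ` is the value of `⌊g √(βa βb)⌋`. -/
def Λ (κ : LinkState) (γ : ℕ) (g s : ℝ) : ℝ :=
  p.prob κ γ * ∑ i : Fin 4, p.gainProb i *
    (1 + s * p.C κ * p.gainValue i
      / (p.nak κ * Real.sqrt ((g ^ 2 + p.Δh ^ 2) ^ p.α κ))) ^ (-p.nak κ)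

/-- `O_e(s, q)`. -/
def Oe (s q : ℝ) : ℝ :=
  ∑' γ₁ : ℕ, ∫ g in ((γ₁ : ℝ) / p.rootβ)..(((γ₁ : ℝ) + 1) / p.rootβ),
    (p.Λ .los γ₁ g s + p.Λ .nlos γ₁ g s) * p.shape.distDensity g q

end UplinkParams

/-! ### The uplink network -/

/-- An uplink network on `(Ω, P)` with parameters `p`, seen from the UAV `v₀` at the origin.
`Φ` (on `(Ω₀, P₀)`) is the point configuration of all UAVs, `parent 0 = v₀, parent 1, …` are the
UAVs seen from the typical one, `size n` is the number of users in the cluster of `parent n`, with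
law `sizeLaw`, and the other variables belong to the `k`-th user of the cluster of `parent n`
(used for `k < size n`). -/
structure UplinkNetwork (p : UplinkParams) {Ω₀ Ω : Type*} [MeasurableSpace Ω₀] [MeasurableSpace Ω]
    (Φ : ℕ → Ω₀ → Plane) (P₀ : Measure Ω₀) (sizeLaw : Measure ℕ) (P : Measure Ω) where
  parent : ℕ → Ω → Plane
  size : ℕ → Ω → ℕ
  /-- displacement of a user from its cluster centre -/
  offset : ℕ → ℕ → Ω → Plane
  /-- uniform variable on `[0, 1]` that decides whether the link is blocked -/
  block : ℕ → ℕ → Ω → ℝ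
  /-- small scale power fading `|ĥ|²` of a line-of-sight link -/
  fadeLos : ℕ → ℕ → Ω → ℝ
  /-- small scale power fading `|ĥ|²` of a non-line-of-sight link -/
  fadeNlos : ℕ → ℕ → Ω → ℝ
  /-- directivity gain -/
  gain : ℕ → ℕ → Ω → ℝ
  palm : IsPalmVersion p.lam Φ P₀ parent P
  measurable_size : ∀ n, Measurable (size n)
  measurable_offset : ∀ n k, Measurable (offset n k)
  measurable_block : ∀ n k, Measurable (block n k)
  measurable_fadeLos : ∀ n k, Measurable (fadeLos n k)
  measurable_fadeNlos : ∀ n k, Measurable (fadeNlos n k)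
  measurable_gain : ∀ n k, Measurable (gain n k)
  size_law : ∀ n, HasLaw (size n) sizeLaw P
  user_law : ∀ n k, HasLaw
    (fun ω => (offset n k ω, block n k ω, fadeLos n k ω, fadeNlos n k ω, gain n k ω)) p.userLaw P
  size_indep : iIndepFun size P
  user_indep : iIndepFun (fun (i : ℕ × ℕ) ω =>
    (offset i.1 i.2 ω, block i.1 i.2 ω, fadeLos i.1 i.2 ω, fadeNlos i.1 i.2 ω, gain i.1 i.2 ω)) P
  /-- cluster sizes and users are independent -/
  size_user_indep : IndepFun (fun ω n => size n ω) (fun ω (i : ℕ × ℕ) =>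
    (offset i.1 i.2 ω, block i.1 i.2 ω, fadeLos i.1 i.2 ω, fadeNlos i.1 i.2 ω, gain i.1 i.2 ω)) P
  /-- cluster centres are independent of cluster sizes and users -/
  parent_indep : IndepFun (fun ω n => parent n ω) (fun ω => (fun n => size n ω,
    fun i : ℕ × ℕ => (offset i.1 i.2 ω, block i.1 i.2 ω, fadeLos i.1 i.2 ω,
      fadeNlos i.1 i.2 ω, gain i.1 i.2 ω))) P

namespace UplinkNetwork

variable {p : UplinkParams} {Ω₀ Ω : Type*} [MeasurableSpace Ω₀] [MeasurableSpace Ω]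
  {Φ : ℕ → Ω₀ → Plane} {P₀ : Measure Ω₀} {sizeLaw : Measure ℕ} {P : Measure Ω}
  (N : UplinkNetwork p Φ P₀ sizeLaw P)

/-- The position of the `k`-th user in the cluster of the `n`-th UAV. -/
def user (n k : ℕ) (ω : Ω) : Plane := N.parent n ω + N.offset n k ω

/-- The channel gain `H_g` from that user to the UAV at the origin: path loss times directivity
gain times power fading, where the link is in line of sight with probability
`p_L(γ(‖u‖))` given the position `u`, and not in line of sight otherwise. -/
def channelGain (n k : ℕ) (ω : Ω) : ℝ :=
  if N.block n k ω < p.prob .los (p.γ ‖N.user n k ω‖) then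
    p.pathLoss .los ‖N.user n k ω‖ * N.gain n k ω * N.fadeLos n k ω
  else
    p.pathLoss .nlos ‖N.user n k ω‖ * N.gain n k ω * N.fadeNlos n k ω

/-- The inter-cluster interference: the sum over all users of all clusters except that of `v₀`. -/
def interInterference (ω : Ω) : ℝ≥0∞ :=
  ∑' n : {n : ℕ // n ≠ 0}, ∑ k ∈ Finset.range (N.size n ω), ENNReal.ofReal (N.channelGain n k ω)

/-- The Laplace transform `E[exp(-s I_inter)]` of the inter-cluster interference. -/
def laplaceInter (s : ℝ) : ℝ :=
  ∫ ω, expNeg (ENNReal.ofReal s * N.interInterference ω) ∂P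

end UplinkNetwork

end

/-! Given the cluster centres, the clusters are independent. A cluster centred at x multiplies the
conditional Laplace transform by G(z(x)), where z(x) is the Laplace transform of the gain of one of
its users and G is the generating function of the cluster size: z^N̄ or exp(-n̄(1 - z)). Writing
G(z(x)) = e^{-w(x)} reduces the claim to the expectation of e^{-∑ w(X_n)} over the centres X_n other
than the origin.

By Slivnyak's theorem these centres have the Laplace functional exp(-λ ∫ (1 - e^{-w})) of the
Poisson configuration itself. It is derived here from the defining identity of the Palm
distribution. That identity is applied to the points in a tiny ball, and the sum over those points
is evaluated by the Campbell-Mecke formula (`lintegral_count_mul_eNeg`), which is a derivative of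
the Poisson Laplace functional (`laplace_functional`). The comparison of w with its small translates
needs uniform continuity, so `reduced_laplace` is stated for continuous w. Continuity of z holds
because z is a convolution of a bounded function with an integrable density.

It remains to identify z(x) with O_e(s, ‖x‖). Blockage, fading and antenna gain are averaged first
(`lintegral_channelLaw`). The distance of a user then gets the density f by polar coordinates: the
integral over angles is a Bessel function for Thomas clusters and an arccosine for Matérn clusters
(`lintegral_angle`). Polar coordinates for the centre finally give the factor 2π q dq. -/

/-! ### The function e^{-x} on [0, ∞]. -/

/-- `exp (-x)` as a map of `[0, ∞]` to itself. -/
noncomputable def eNeg (x : ℝ≥0∞) : ℝ≥0∞ := EReal.exp (-(x : EReal))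

lemma eNeg_zero : eNeg 0 = 1 := by simp [eNeg]

lemma eNeg_top : eNeg ∞ = 0 := by simp [eNeg]

lemma eNeg_ofReal {x : ℝ} (hx : 0 ≤ x) :
    eNeg (ENNReal.ofReal x) = ENNReal.ofReal (Real.exp (-x)) := by
  rw [eNeg, EReal.coe_ennreal_ofReal, max_eq_left hx, ← EReal.coe_neg, EReal.exp_coe]

lemma eNeg_eq_ofReal_expNeg (x : ℝ≥0∞) : eNeg x = ENNReal.ofReal (expNeg x) := by
  by_cases hx : x = ∞
  · simp [hx, eNeg_top, expNeg]
  · rw [expNeg, if_neg hx, ← eNeg_ofReal ENNReal.toReal_nonneg, ENNReal.ofReal_toReal hx]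

lemma expNeg_nonneg (x : ℝ≥0∞) : 0 ≤ expNeg x := by
  unfold expNeg; split_ifs <;> positivity

lemma toReal_eNeg (x : ℝ≥0∞) : (eNeg x).toReal = expNeg x := by
  rw [eNeg_eq_ofReal_expNeg, ENNReal.toReal_ofReal (expNeg_nonneg x)]

lemma eNeg_add (x y : ℝ≥0∞) : eNeg (x + y) = eNeg x * eNeg y := by
  rw [eNeg, eNeg, eNeg, ← EReal.exp_add, EReal.coe_ennreal_add, EReal.neg_add]
  · rfl
  · exact Or.inl (EReal.coe_ennreal_ne_bot x)
  · exact Or.inr (EReal.coe_ennreal_ne_bot y)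

lemma eNeg_sum {ι : Type*} (s : Finset ι) (f : ι → ℝ≥0∞) :
    eNeg (∑ i ∈ s, f i) = ∏ i ∈ s, eNeg (f i) := by
  classical
  induction s using Finset.induction_on with
  | empty => simp [eNeg_zero]
  | insert a s ha ih => rw [Finset.sum_insert ha, Finset.prod_insert ha, eNeg_add, ih]

lemma eNeg_antitone : Antitone eNeg := fun _ _ h =>
  EReal.exp_monotone (EReal.neg_le_neg_iff.2 (EReal.coe_ennreal_le_coe_ennreal_iff.2 h))

lemma eNeg_le_one (x : ℝ≥0∞) : eNeg x ≤ 1 := eNeg_zero ▸ eNeg_antitone zero_le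

lemma eNeg_ne_top (x : ℝ≥0∞) : eNeg x ≠ ∞ := ((eNeg_le_one x).trans_lt ENNReal.one_lt_top).ne

lemma eNeg_ne_zero {x : ℝ≥0∞} (hx : x ≠ ∞) : eNeg x ≠ 0 := by
  simpa [eNeg] using hx

lemma continuous_eNeg : Continuous eNeg :=
  ENNReal.continuous_exp.comp (continuous_neg.comp continuous_coe_ennreal_ereal)

lemma measurable_eNeg : Measurable eNeg := continuous_eNeg.measurable

lemma eNeg_nat_mul (k : ℕ) (x : ℝ≥0∞) : eNeg (k * x) = eNeg x ^ k := by
  have := eNeg_sum (Finset.range k) (fun _ => x)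
  simpa using this

lemma one_sub_eNeg_le (x : ℝ≥0∞) : 1 - eNeg x ≤ x := by
  by_cases hx : x = ∞
  · simp [hx]
  · rw [← ENNReal.ofReal_toReal hx, eNeg_ofReal ENNReal.toReal_nonneg, ← ENNReal.ofReal_one,
      ← ENNReal.ofReal_sub _ (Real.exp_nonneg _)]
    apply ENNReal.ofReal_le_ofReal
    linarith [Real.add_one_le_exp (-x.toReal)]

/-- The function 1 - e^{-x} is increasing and 1-Lipschitz. This controls the Poisson exponent when
the test function is perturbed. -/
lemma one_sub_eNeg_le_add {a b t : ℝ≥0∞} (h : b ≤ a + t) :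
    1 - eNeg b ≤ (1 - eNeg a) + t := by
  have h1 : eNeg a * eNeg t ≤ eNeg b := by rw [← eNeg_add]; exact eNeg_antitone h
  have h2 : eNeg a ≤ eNeg a * eNeg t + t := by
    calc eNeg a = eNeg a * (eNeg t + (1 - eNeg t)) := by
          rw [add_tsub_cancel_of_le (eNeg_le_one t), mul_one]
      _ = eNeg a * eNeg t + eNeg a * (1 - eNeg t) := mul_add _ _ _
      _ ≤ eNeg a * eNeg t + 1 * t := by gcongr; exacts [eNeg_le_one a, one_sub_eNeg_le t]
      _ = _ := by rw [one_mul]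
  rw [tsub_le_iff_right]
  calc (1 : ℝ≥0∞) = (1 - eNeg a) + eNeg a := (tsub_add_cancel_of_le (eNeg_le_one a)).symm
    _ ≤ (1 - eNeg a) + (eNeg b + t) := by gcongr; exact h2.trans (by gcongr)
    _ = _ := by ring

/-! ### Generating function and mean of the Poisson distribution. -/

lemma lintegral_poissonMeasure (m : ℝ≥0) (f : ℕ → ℝ≥0∞) :
    ∫⁻ k, f k ∂poissonMeasure m =
      ∑' k, ENNReal.ofReal (Real.exp (-m) * m ^ k / k !) * f k := by
  simp [poissonMeasure, lintegral_sum_measure]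

/-- The probability generating function of the Poisson distribution. -/
lemma lintegral_pow_poissonMeasure (m : ℝ≥0) {z : ℝ} (hz : 0 ≤ z) :
    ∫⁻ k, ENNReal.ofReal z ^ k ∂poissonMeasure m =
      ENNReal.ofReal (Real.exp (-(m * (1 - z)))) := by
  rw [lintegral_poissonMeasure]
  have h : HasSum (fun k : ℕ => Real.exp (-m) * ((m * z) ^ k / k !))
      (Real.exp (-m) * Real.exp (m * z)) := by
    rw [Real.exp_eq_exp_ℝ]
    exact (NormedSpace.expSeries_div_hasSum_exp ((m : ℝ) * z)).mul_left _
  have h' : ∀ k : ℕ, ENNReal.ofReal (Real.exp (-m) * m ^ k / k !) * ENNReal.ofReal z ^ k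
      = ENNReal.ofReal (Real.exp (-m) * ((m * z) ^ k / k !)) := by
    intro k
    rw [← ENNReal.ofReal_pow hz, ← ENNReal.ofReal_mul (by positivity)]
    congr 1
    rw [mul_pow]; ring
  simp_rw [h']
  rw [← ENNReal.ofReal_tsum_of_nonneg (fun k => by positivity) h.summable, h.tsum_eq,
    ← Real.exp_add]
  congr 2; ring

lemma lintegral_natCast_poissonMeasure (m : ℝ≥0) :
    ∫⁻ k, (k : ℝ≥0∞) ∂poissonMeasure m = m := by
  rw [lintegral_poissonMeasure, tsum_eq_zero_add' ENNReal.summable]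
  simp only [Nat.cast_zero, mul_zero, zero_add]
  have h : ∀ k : ℕ, ENNReal.ofReal (Real.exp (-m) * m ^ (k + 1) / (k + 1)!) * ((k + 1 : ℕ) : ℝ≥0∞)
      = (m : ℝ≥0∞) * (ENNReal.ofReal (Real.exp (-m) * m ^ k / k !) * 1) := by
    intro k
    rw [← ENNReal.ofReal_natCast, ← ENNReal.ofReal_mul (by positivity),
      ← ENNReal.ofReal_coe_nnreal, mul_one, ← ENNReal.ofReal_mul (by positivity)]
    congr 1
    rw [Nat.factorial_succ]
    push_cast
    field_simp
    rw [pow_succ']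
  simp_rw [h]
  rw [ENNReal.tsum_mul_left, ← lintegral_poissonMeasure m (fun _ => 1)]
  simp

/-- This is the generating function at z = e^{-c}. The case c = ∞ is z = 0, with ∞ * 0 = 0 matching
0 ^ 0 = 1. -/
lemma lintegral_eNeg_mul_poissonMeasure (m : ℝ≥0) (c : ℝ≥0∞) :
    ∫⁻ k, eNeg (c * k) ∂poissonMeasure m = eNeg (m * (1 - eNeg c)) := by
  have h : ∀ k : ℕ, eNeg (c * k) = ENNReal.ofReal (expNeg c) ^ k := fun k => by
    rw [mul_comm, eNeg_nat_mul, eNeg_eq_ofReal_expNeg]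
  have hle : expNeg c ≤ 1 := by
    have := ENNReal.toReal_mono ENNReal.one_ne_top (eNeg_le_one c)
    rwa [toReal_eNeg, ENNReal.toReal_one] at this
  simp_rw [h]
  rw [lintegral_pow_poissonMeasure m (expNeg_nonneg c), eNeg_eq_ofReal_expNeg c,
    ← ENNReal.ofReal_one, ← ENNReal.ofReal_sub _ (expNeg_nonneg c), ← ENNReal.ofReal_coe_nnreal,
    ← ENNReal.ofReal_mul (by positivity), eNeg_ofReal]
  exact mul_nonneg m.2 (by linarith)

/-! ### The Laplace functional of a Poisson configuration. -/

section Config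

variable {Ω : Type*}

lemma lintegral_config {X : ℕ → Ω → Plane} {ψ : Plane → ℝ≥0∞} (hψ : Measurable ψ) (ω : Ω) :
    ∫⁻ y, ψ y ∂config X ω = ∑' n, ψ (X n ω) := by
  simp [config, lintegral_sum_measure, lintegral_dirac' _ hψ]

variable [MeasurableSpace Ω]

lemma measurable_config {X : ℕ → Ω → Plane} (hX : ∀ n, Measurable (X n)) :
    Measurable (config X) := by
  refine Measure.measurable_of_measurable_coe _ fun A hA => ?_
  have : (fun ω => config X ω A) = fun ω => ∑' n, A.indicator 1 (X n ω) := by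
    ext ω
    rw [← lintegral_indicator_one hA, lintegral_config (measurable_one.indicator hA)]
  rw [this]
  exact Measurable.tsum fun n => (measurable_one.indicator hA).comp (hX n)

lemma measurable_config_apply {X : ℕ → Ω → Plane} (hX : ∀ n, Measurable (X n)) {A : Set Plane}
    (hA : MeasurableSet A) : Measurable (fun ω => config X ω A) :=
  (Measure.measurable_coe hA).comp (measurable_config hX)

lemma measurable_lintegral_config {X : ℕ → Ω → Plane} (hX : ∀ n, Measurable (X n))
    {ψ : Plane → ℝ≥0∞} (hψ : Measurable ψ) : Measurable (fun ω => ∫⁻ y, ψ y ∂config X ω) :=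
  (Measure.measurable_lintegral hψ).comp (measurable_config hX)

namespace IsHomogeneousPPP

variable {lam : ℝ} {X : ℕ → Ω → Plane} {P : Measure Ω}

lemma lintegral_comp_count (h : IsHomogeneousPPP lam X P) {A : Set Plane}
    (hA : MeasurableSet A) (hAf : volume A ≠ ∞) {f : ℝ≥0∞ → ℝ≥0∞} (hf : Measurable f) :
    ∫⁻ ω, f (config X ω A) ∂P
      = ∫⁻ k : ℕ, f k ∂poissonMeasure (lam * (volume A).toReal).toNNReal := by
  rw [(h.count_law A hA hAf).lintegral_comp hf.aemeasurable,
    lintegral_map hf measurable_from_nat]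

lemma mean_toNNReal {A : Set Plane} (hlam : 0 ≤ lam) (hAf : volume A ≠ ∞) :
    (((lam * (volume A).toReal).toNNReal : ℝ≥0) : ℝ≥0∞) = ENNReal.ofReal lam * volume A := by
  rw [← ENNReal.ofReal, ENNReal.ofReal_mul hlam, ENNReal.ofReal_toReal hAf]

lemma lintegral_count (h : IsHomogeneousPPP lam X P) (hlam : 0 ≤ lam) {A : Set Plane}
    (hA : MeasurableSet A) (hAf : volume A ≠ ∞) :
    ∫⁻ ω, config X ω A ∂P = ENNReal.ofReal lam * volume A := by
  rw [h.lintegral_comp_count hA hAf (f := fun x => x) measurable_id,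
    lintegral_natCast_poissonMeasure, mean_toNNReal hlam hAf]

lemma laplace_count (h : IsHomogeneousPPP lam X P) (hlam : 0 ≤ lam) {A : Set Plane}
    (hA : MeasurableSet A) (hAf : volume A ≠ ∞) (c : ℝ≥0∞) :
    ∫⁻ ω, eNeg (c * config X ω A) ∂P
      = eNeg (ENNReal.ofReal lam * ((1 - eNeg c) * volume A)) := by
  rw [h.lintegral_comp_count hA hAf (f := fun x => eNeg (c * x))
      (measurable_eNeg.comp (measurable_const_mul c)),
    lintegral_eNeg_mul_poissonMeasure, mean_toNNReal hlam hAf]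
  congr 1; ring

/-- Counts in disjoint sets are independent, so the expectation of the product of exponentials
factors into one-set transforms. -/
lemma laplace_sum_count (h : IsHomogeneousPPP lam X P) (hlam : 0 ≤ lam) {ι : Type*}
    (s : Finset ι) (A : ι → Set Plane) (hA : ∀ i, MeasurableSet (A i))
    (hAf : ∀ i ∈ s, volume (A i) ≠ ∞) (hd : Pairwise (Function.onFun Disjoint A)) (c : ι → ℝ≥0∞) :
    ∫⁻ ω, eNeg (∑ i ∈ s, c i * config X ω (A i)) ∂P
      = eNeg (ENNReal.ofReal lam * ∑ i ∈ s, (1 - eNeg (c i)) * volume (A i)) := by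
  set e : Fin s.card ≃ s := s.equivFin.symm
  have hi : iIndepFun (fun j ω => config X ω (A (e j))) P :=
    h.count_indep _ (fun j => A (e j)) (fun j => hA _) fun j k hjk =>
      hd fun heq => hjk (e.injective (Subtype.ext heq))
  have hi2 := hi.comp (fun j x => eNeg (c (e j) * x))
    (fun j => measurable_eNeg.comp (measurable_const_mul _))
  have hsum : ∀ f : ι → ℝ≥0∞, ∑ i ∈ s, f i = ∑ j : Fin s.card, f (e j) := fun f => by
    rw [← Finset.sum_coe_sort, ← e.sum_comp]
  simp_rw [hsum, Finset.mul_sum, eNeg_sum]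
  refine (lintegral_prod_eq_prod_lintegral_of_indepFun Finset.univ _ hi2 ?_).trans ?_
  · exact fun j => measurable_eNeg.comp
      ((measurable_const_mul _).comp (measurable_config_apply h.measurable (hA _)))
  · refine Finset.prod_congr rfl fun j _ => ?_
    exact h.laplace_count hlam (hA _) (hAf _ (e j).2) _

/-- A simple function is a finite combination of indicators of its level sets. The value 0 is
dropped: it contributes to neither side, while its level set may have infinite area. -/
lemma laplace_simpleFunc (h : IsHomogeneousPPP lam X P) (hlam : 0 ≤ lam)
    (f : SimpleFunc Plane ℝ≥0∞) (hf : ∀ c, c ≠ 0 → volume (f ⁻¹' {c}) ≠ ∞) :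
    ∫⁻ ω, eNeg (∫⁻ y, f y ∂config X ω) ∂P
      = eNeg (ENNReal.ofReal lam * ∫⁻ y, (1 - eNeg (f y))) := by
  classical
  have h1 : ∀ ω, ∫⁻ y, f y ∂config X ω
      = ∑ c ∈ f.range.filter (· ≠ 0), c * config X ω (f ⁻¹' {c}) := fun ω => by
    rw [SimpleFunc.lintegral_eq_lintegral, SimpleFunc.lintegral, Finset.sum_filter_of_ne]
    rintro c - hc rfl
    simp at hc
  have h2 : ∫⁻ y, (1 - eNeg (f y))
      = ∑ c ∈ f.range.filter (· ≠ 0), (1 - eNeg c) * volume (f ⁻¹' {c}) := by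
    have := SimpleFunc.lintegral_eq_lintegral (f.map fun c => 1 - eNeg c) volume
    rw [SimpleFunc.map_lintegral] at this
    simp only [SimpleFunc.map_apply] at this
    rw [this, Finset.sum_filter_of_ne]
    rintro c - hc rfl
    simp [eNeg_zero] at hc
  simp_rw [h1, h2]
  refine h.laplace_sum_count hlam _ (fun c => f ⁻¹' {c}) (fun c => f.measurableSet_fiber c)
    (fun c hc => hf c (Finset.mem_filter.1 hc).2) (fun c d hcd => ?_) id
  exact (disjoint_singleton.2 hcd).preimage f

/-- The Laplace functional of a homogeneous Poisson point configuration. -/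
theorem laplace_functional [IsProbabilityMeasure P] (h : IsHomogeneousPPP lam X P)
    (hlam : 0 ≤ lam) {ψ : Plane → ℝ≥0∞} (hψ : Measurable ψ) :
    ∫⁻ ω, eNeg (∫⁻ y, ψ y ∂config X ω) ∂P
      = eNeg (ENNReal.ofReal lam * ∫⁻ y, (1 - eNeg (ψ y))) := by
  -- Restriction to balls gives the nonzero level sets finite area; the approximations still
  -- increase to ψ.
  let f : ℕ → SimpleFunc Plane ℝ≥0∞ := fun n =>
    (SimpleFunc.eapprox ψ n).restrict (Metric.ball 0 n)
  have hfa : ∀ n y, f n y = (Metric.ball 0 (n : ℝ)).indicator (SimpleFunc.eapprox ψ n) y :=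
    fun n y => SimpleFunc.restrict_apply _ Metric.isOpen_ball.measurableSet y
  have hmono : ∀ y, Monotone fun n => f n y := fun y m n hmn => by
    simp only [hfa]
    exact (indicator_le_indicator (SimpleFunc.monotone_eapprox ψ hmn y)).trans
      (indicator_le_indicator_of_subset (Metric.ball_subset_ball (by exact_mod_cast hmn))
        (fun _ => zero_le) y)
  have htend : ∀ y, Filter.Tendsto (fun n => f n y) Filter.atTop (nhds (ψ y)) := fun y => by
    have h1 := tendsto_atTop_iSup (f := fun n => SimpleFunc.eapprox ψ n y)
      (fun m n hmn => SimpleFunc.monotone_eapprox ψ hmn y)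
    rw [SimpleFunc.iSup_eapprox_apply hψ] at h1
    refine h1.congr' ?_
    obtain ⟨m, hm⟩ := exists_nat_gt ‖y‖
    filter_upwards [Filter.eventually_ge_atTop m] with n hn
    rw [hfa, indicator_of_mem]
    rw [mem_ball_zero_iff]
    exact hm.trans_le (by exact_mod_cast hn)
  have hsim : ∀ n, ∫⁻ ω, eNeg (∫⁻ y, f n y ∂config X ω) ∂P
      = eNeg (ENNReal.ofReal lam * ∫⁻ y, (1 - eNeg (f n y))) := fun n => by
    refine h.laplace_simpleFunc hlam _ fun c hc => ?_
    refine ((measure_mono fun y hy => ?_).trans_lt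
      (measure_ball_lt_top (x := (0 : Plane)) (r := n))).ne
    by_contra hy'
    rw [mem_preimage, hfa, indicator_of_notMem hy'] at hy
    exact hc hy.symm
  have hL : Filter.Tendsto (fun n => ∫⁻ ω, eNeg (∫⁻ y, f n y ∂config X ω) ∂P) Filter.atTop
      (nhds (∫⁻ ω, eNeg (∫⁻ y, ψ y ∂config X ω) ∂P)) := by
    refine tendsto_lintegral_of_dominated_convergence (fun _ => 1)
      (fun n => measurable_eNeg.comp (measurable_lintegral_config h.measurable (f n).measurable))
      (fun n => .of_forall fun _ => eNeg_le_one _) (by simp) (.of_forall fun ω => ?_)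
    exact (continuous_eNeg.tendsto _).comp
      (lintegral_tendsto_of_tendsto_of_monotone (fun n => (f n).measurable.aemeasurable)
        (.of_forall hmono) (.of_forall htend))
  have hR : Filter.Tendsto (fun n => eNeg (ENNReal.ofReal lam * ∫⁻ y, (1 - eNeg (f n y))))
      Filter.atTop (nhds (eNeg (ENNReal.ofReal lam * ∫⁻ y, (1 - eNeg (ψ y))))) := by
    refine (continuous_eNeg.tendsto _).comp (ENNReal.Tendsto.const_mul ?_
      (Or.inr ENNReal.ofReal_ne_top))
    refine lintegral_tendsto_of_tendsto_of_monotone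
      (fun n => ((measurable_eNeg.comp (f n).measurable).const_sub 1).aemeasurable)
      (.of_forall fun y m n hmn => tsub_le_tsub_left (eNeg_antitone (hmono y hmn)) 1)
      (.of_forall fun y => ?_)
    exact ENNReal.Tendsto.sub tendsto_const_nhds ((continuous_eNeg.tendsto _).comp (htend y))
      (Or.inl ENNReal.one_ne_top)
  simp_rw [hsim] at hL
  exact tendsto_nhds_unique hL hR

end IsHomogeneousPPP
end Config

/-! ### The Campbell-Mecke formula as a derivative of the Laplace functional. -/

lemma mul_eNeg_le (x : ℝ≥0∞) : x * eNeg x ≤ 1 - eNeg x := by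
  by_cases hx : x = ∞
  · simp [hx, eNeg_top]
  · rw [← ENNReal.ofReal_toReal hx, eNeg_ofReal ENNReal.toReal_nonneg, ← ENNReal.ofReal_one,
      ← ENNReal.ofReal_sub _ (Real.exp_nonneg _), ← ENNReal.ofReal_mul ENNReal.toReal_nonneg]
    apply ENNReal.ofReal_le_ofReal
    have h := mul_le_mul_of_nonneg_right (Real.add_one_le_exp x.toReal)
      (Real.exp_nonneg (-x.toReal))
    rw [← Real.exp_add, add_neg_cancel, Real.exp_zero] at h
    linarith

lemma one_sub_mul_eNeg (a b : ℝ≥0∞) : (1 - eNeg b) * eNeg a = eNeg a - eNeg (a + b) := by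
  rw [ENNReal.sub_mul (fun _ _ => eNeg_ne_top a), one_mul, eNeg_add, mul_comm]

/-- Since y is finite, x n tends to 0. The bounds x e^{-x} ≤ 1 - e^{-x} ≤ x then squeeze the
sequence. -/
lemma tendsto_natCast_mul_one_sub_eNeg {x : ℕ → ℝ≥0∞} {y : ℝ≥0∞} (hy : y ≠ ∞)
    (h : Filter.Tendsto (fun n : ℕ => (n : ℝ≥0∞) * x n) Filter.atTop (nhds y)) :
    Filter.Tendsto (fun n : ℕ => (n : ℝ≥0∞) * (1 - eNeg (x n))) Filter.atTop (nhds y) := by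
  have hx : Filter.Tendsto x Filter.atTop (nhds 0) := by
    have h1 := ENNReal.Tendsto.mul h (Or.inr (by simp)) ENNReal.tendsto_inv_nat_nhds_zero
      (Or.inr hy)
    rw [mul_zero] at h1
    refine h1.congr' ?_
    filter_upwards [Filter.eventually_gt_atTop 0] with n hn
    rw [mul_right_comm, ENNReal.mul_inv_cancel (by exact_mod_cast hn.ne')
      (ENNReal.natCast_ne_top n), one_mul]
  have he : Filter.Tendsto (fun n => eNeg (x n)) Filter.atTop (nhds 1) := by
    have := (continuous_eNeg.tendsto 0).comp hx
    rwa [eNeg_zero] at this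
  have hlow := ENNReal.Tendsto.mul h (Or.inr ENNReal.one_ne_top) he (Or.inl one_ne_zero)
  rw [mul_one] at hlow
  refine tendsto_of_tendsto_of_tendsto_of_le_of_le hlow h (fun n => ?_) (fun n => ?_)
  · change (n : ℝ≥0∞) * x n * eNeg (x n) ≤ n * (1 - eNeg (x n))
    rw [mul_assoc]
    gcongr
    exact mul_eNeg_le _
  · change (n : ℝ≥0∞) * (1 - eNeg (x n)) ≤ n * x n
    gcongr
    exact one_sub_eNeg_le _

section

variable {Ω : Type*} [MeasurableSpace Ω] {lam : ℝ} {X : ℕ → Ω → Plane} {P : Measure Ω}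

lemma lintegral_one_sub_eNeg_add_indicator {ψ : Plane → ℝ≥0∞} (hψ : Measurable ψ)
    {B : Set Plane} (hB : MeasurableSet B) (t : ℝ≥0∞) :
    ∫⁻ y, (1 - eNeg (ψ y + B.indicator (fun _ => t) y))
      = (∫⁻ y, (1 - eNeg (ψ y))) + (1 - eNeg t) * ∫⁻ y in B, eNeg (ψ y) := by
  have hm : Measurable fun y => eNeg (ψ y) := measurable_eNeg.comp hψ
  rw [← lintegral_indicator hB, ← lintegral_const_mul _ (hm.indicator hB),
    ← lintegral_add_left (hm.const_sub 1)]
  refine lintegral_congr fun y => ?_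
  by_cases hy : y ∈ B
  · rw [indicator_of_mem hy, indicator_of_mem hy, one_sub_mul_eNeg,
      tsub_add_tsub_cancel (eNeg_le_one _) (eNeg_antitone le_self_add)]
  · simp [indicator_of_notMem hy]

/-- The Campbell-Mecke formula for a count weighted by an exponential functional. -/
theorem IsHomogeneousPPP.lintegral_count_mul_eNeg [IsProbabilityMeasure P]
    (h : IsHomogeneousPPP lam X P) (hlam : 0 ≤ lam) {ψ : Plane → ℝ≥0∞} (hψ : Measurable ψ)
    {B : Set Plane} (hB : MeasurableSet B) (hBf : volume B ≠ ∞) :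
    ∫⁻ ω, config X ω B * eNeg (∫⁻ y, ψ y ∂config X ω) ∂P
      = ENNReal.ofReal lam * (∫⁻ y in B, eNeg (ψ y))
        * eNeg (ENNReal.ofReal lam * ∫⁻ y, (1 - eNeg (ψ y))) := by
  set D := ∫⁻ y in B, eNeg (ψ y) with hD
  set A := eNeg (ENNReal.ofReal lam * ∫⁻ y, (1 - eNeg (ψ y))) with hA
  have hDf : D ≠ ∞ := by
    refine ((lintegral_mono (g := fun _ => 1) fun y => eNeg_le_one (ψ y)).trans_lt ?_).ne
    simpa using hBf.lt_top
  have hmB := measurable_config_apply h.measurable hB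
  have hmψ := measurable_lintegral_config h.measurable hψ
  have hmean : ∫⁻ ω, config X ω B ∂P ≠ ∞ := by
    rw [h.lintegral_count hlam hB hBf]
    exact ENNReal.mul_ne_top ENNReal.ofReal_ne_top hBf
  have hsplit : ∀ (t : ℝ≥0∞) (ω : Ω),
      ∫⁻ y, (ψ y + B.indicator (fun _ => t) y) ∂config X ω
        = (∫⁻ y, ψ y ∂config X ω) + t * config X ω B := fun t ω => by
    rw [lintegral_add_left hψ, lintegral_indicator_const hB]
  -- A difference quotient of step 1/n for the Laplace functional of ψ + t 1_B at t = 0. As n grows,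
  -- the left side tends to the weighted count and the right side to the derivative of the explicit
  -- formula.
  have hid : ∀ n : ℕ, ∫⁻ ω, n * ((1 - eNeg ((n : ℝ≥0∞)⁻¹ * config X ω B))
        * eNeg (∫⁻ y, ψ y ∂config X ω)) ∂P
      = n * (1 - eNeg (ENNReal.ofReal lam * ((1 - eNeg (n : ℝ≥0∞)⁻¹) * D))) * A := fun n => by
    rw [lintegral_const_mul', mul_assoc]
    · congr 1
      simp_rw [one_sub_mul_eNeg, ← hsplit]
      rw [lintegral_sub, h.laplace_functional hlam hψ,
        h.laplace_functional hlam
          (ψ := fun y => ψ y + B.indicator (fun _ => (n : ℝ≥0∞)⁻¹) y)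
          (hψ.add (measurable_const.indicator hB)),
        lintegral_one_sub_eNeg_add_indicator hψ hB, hA, one_sub_mul_eNeg, mul_add]
      · exact measurable_eNeg.comp (measurable_lintegral_config h.measurable
          (hψ.add (measurable_const.indicator hB)))
      · exact ((lintegral_mono (g := fun _ => 1) fun y => eNeg_le_one _).trans_lt (by simp)).ne
      · exact .of_forall fun ω => eNeg_antitone (lintegral_mono fun y => le_self_add)
    · exact ENNReal.natCast_ne_top n
  have hL : Filter.Tendsto (fun n : ℕ => ∫⁻ ω, n * ((1 - eNeg ((n : ℝ≥0∞)⁻¹ * config X ω B))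
        * eNeg (∫⁻ y, ψ y ∂config X ω)) ∂P) Filter.atTop
      (nhds (∫⁻ ω, config X ω B * eNeg (∫⁻ y, ψ y ∂config X ω) ∂P)) := by
    -- The quotients are dominated by the number of points in B, whose mean is finite.
    refine tendsto_lintegral_of_dominated_convergence (fun ω => config X ω B)
      (fun n => ?_) (fun n => .of_forall fun ω => ?_) hmean ?_
    · exact (((measurable_eNeg.comp (hmB.const_mul _)).const_sub 1).mul
        (measurable_eNeg.comp hmψ)).const_mul _
    · rcases Nat.eq_zero_or_pos n with rfl | hn
      · simp
      calc (n : ℝ≥0∞) * ((1 - eNeg ((n : ℝ≥0∞)⁻¹ * config X ω B))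
            * eNeg (∫⁻ y, ψ y ∂config X ω))
          ≤ n * (((n : ℝ≥0∞)⁻¹ * config X ω B) * 1) := by
            gcongr
            exacts [one_sub_eNeg_le _, eNeg_le_one _]
        _ = config X ω B := by
            rw [mul_one, ← mul_assoc, ENNReal.mul_inv_cancel (by exact_mod_cast hn.ne')
              (ENNReal.natCast_ne_top n), one_mul]
    · filter_upwards [ae_lt_top hmB hmean] with ω hω
      simp_rw [← mul_assoc]
      refine ENNReal.Tendsto.mul_const (tendsto_natCast_mul_one_sub_eNeg hω.ne ?_)
        (Or.inr (eNeg_ne_top _))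
      refine tendsto_const_nhds.congr' ?_
      filter_upwards [Filter.eventually_gt_atTop 0] with n hn
      rw [← mul_assoc, ENNReal.mul_inv_cancel (by exact_mod_cast hn.ne')
              (ENNReal.natCast_ne_top n), one_mul]
  have hR : Filter.Tendsto (fun n : ℕ =>
      n * (1 - eNeg (ENNReal.ofReal lam * ((1 - eNeg (n : ℝ≥0∞)⁻¹) * D))) * A)
      Filter.atTop (nhds (ENNReal.ofReal lam * D * A)) := by
    refine ENNReal.Tendsto.mul_const (tendsto_natCast_mul_one_sub_eNeg
      (ENNReal.mul_ne_top ENNReal.ofReal_ne_top hDf) ?_) (Or.inr (eNeg_ne_top _))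
    have h1 : Filter.Tendsto (fun n : ℕ => (n : ℝ≥0∞) * (1 - eNeg (n : ℝ≥0∞)⁻¹))
        Filter.atTop (nhds 1) := by
      refine tendsto_natCast_mul_one_sub_eNeg ENNReal.one_ne_top ?_
      refine tendsto_const_nhds.congr' ?_
      filter_upwards [Filter.eventually_gt_atTop 0] with n hn
      rw [ENNReal.mul_inv_cancel (by exact_mod_cast hn.ne') (ENNReal.natCast_ne_top n)]
    have h2 := ENNReal.Tendsto.mul_const (b := ENNReal.ofReal lam * D) h1
      (Or.inl one_ne_zero)
    rw [one_mul] at h2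
    refine h2.congr fun n => by ring
  simp_rw [hid] at hL
  exact tendsto_nhds_unique hL hR

end

/-! ### Slivnyak's theorem from the Palm identity. -/

lemma le_of_forall_mul_eNeg_le {a b c : ℝ≥0∞} (ha : a ≠ ∞) (hc : c ≠ ∞)
    (h : ∀ η : ℝ≥0, 0 < η → a * eNeg (c * η) ≤ b) : a ≤ b := by
  have ht : Filter.Tendsto (fun n : ℕ => a * eNeg (c * ((n : ℝ≥0)⁻¹ : ℝ≥0))) Filter.atTop
      (nhds (a * eNeg (c * (0 : ℝ≥0)))) := by
    refine ENNReal.Tendsto.const_mul ?_ (Or.inr ha)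
    refine (continuous_eNeg.tendsto _).comp (ENNReal.Tendsto.const_mul ?_ (Or.inr hc))
    exact ENNReal.tendsto_coe.2 (tendsto_inv_atTop_nhds_zero_nat (𝕜 := ℝ≥0))
  rw [ENNReal.coe_zero, mul_zero, eNeg_zero, mul_one] at ht
  refine le_of_tendsto ht ?_
  filter_upwards [Filter.eventually_gt_atTop 0] with n hn
  exact h _ (by positivity)

lemma tsum_eq_add_tsum_ne_zero (f : ℕ → ℝ≥0∞) :
    ∑' n, f n = f 0 + ∑' n : {n : ℕ // n ≠ 0}, f n := by
  have := (ENNReal.summable (f := fun n : ({0} : Set ℕ) => f n)).tsum_add_tsum_compl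
    (ENNReal.summable (f := fun n : (({0} : Set ℕ)ᶜ : Set ℕ) => f n))
  rw [← this, tsum_singleton]
  rfl

/-- A continuous function of compact support varies little under small translations. -/
lemma exists_ball_translate_le {w : Plane → ℝ≥0} (hw : Continuous w) (hc : HasCompactSupport w) :
    ∃ R : ℝ, ∀ η : ℝ≥0, 0 < η → ∃ r : ℝ, 0 < r ∧ ∀ x ∈ Metric.ball (0 : Plane) r, ∀ y,
      (w (y - x) : ℝ≥0∞) ≤ w y + (Metric.closedBall 0 R).indicator (fun _ => (η : ℝ≥0∞)) y ∧
      (w y : ℝ≥0∞) ≤ w (y - x) + (Metric.closedBall 0 R).indicator (fun _ => (η : ℝ≥0∞)) y := by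
  obtain ⟨R, hR⟩ := hc.isCompact.isBounded.subset_closedBall (0 : Plane)
  have hzero : ∀ y : Plane, R < ‖y‖ → w y = 0 := fun y hy => by
    by_contra h
    have := hR (subset_tsupport _ h)
    rw [mem_closedBall_zero_iff] at this
    linarith
  refine ⟨R + 1, fun η hη => ?_⟩
  have huc : UniformContinuous w := hc.uniformContinuous_of_continuous hw
  obtain ⟨r, hr, hd⟩ := Metric.uniformContinuous_iff.1 huc η (by exact_mod_cast hη)
  -- Translations shorter than 1 keep the support inside the ball of radius R + 1. This ball does
  -- not depend on η, so the total error is η times a fixed area.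
  refine ⟨min r 1, by positivity, fun x hx y => ?_⟩
  rw [mem_ball_zero_iff, lt_min_iff] at hx
  by_cases hy : y ∈ Metric.closedBall (0 : Plane) (R + 1)
  · rw [indicator_of_mem hy]
    have h1 : dist (w (y - x)) (w y) < η := hd (by simpa [dist_eq_norm] using hx.1)
    rw [NNReal.dist_eq, abs_lt] at h1
    norm_cast
    constructor
    · rw [← NNReal.coe_le_coe]; push_cast; linarith [h1.2]
    · rw [← NNReal.coe_le_coe]; push_cast; linarith [h1.1]
  · rw [indicator_of_notMem hy]
    rw [mem_closedBall_zero_iff, not_le] at hy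
    have h2 : ‖y‖ ≤ ‖y - x‖ + ‖x‖ := by simpa using norm_add_le (y - x) x
    rw [hzero y (by linarith), hzero (y - x) (by linarith [hx.2])]
    simp

namespace IsPalmVersion

variable {Ω Ω₀ : Type*} [MeasurableSpace Ω] [MeasurableSpace Ω₀] {lam : ℝ} {Φ : ℕ → Ω₀ → Plane}
  {P₀ : Measure Ω₀} {X : ℕ → Ω → Plane} {P : Measure Ω}

/-- The Palm identity for events is an equality of two measures on the space of configurations;
integrating F against both gives the formula. -/
lemma lintegral_palm (h : IsPalmVersion lam Φ P₀ X P) (hΦ : ∀ n, Measurable (Φ n))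
    {B : Set Plane} (hB : MeasurableSet B) {F : Measure Plane → ℝ≥0∞} (hF : Measurable F) :
    ∫⁻ ω, ∑' n, B.indicator 1 (Φ n ω) * F (config (fun m ω' => Φ m ω' - Φ n ω') ω) ∂P₀
      = ENNReal.ofReal lam * volume B * ∫⁻ ω, F (config X ω) ∂P := by
  have hm : ∀ n, Measurable (config fun m ω' => Φ m ω' - Φ n ω') := fun n =>
    measurable_config fun m => (hΦ m).sub (hΦ n)
  have heq : Measure.sum (fun n =>
        (P₀.restrict (Φ n ⁻¹' B)).map (config fun m ω' => Φ m ω' - Φ n ω'))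
      = (ENNReal.ofReal lam * volume B) • P.map (config X) := by
    ext 𝒜 h𝒜
    have := h.palm B 𝒜 hB h𝒜
    rw [Measure.smul_apply, Measure.map_apply (measurable_config h.measurable) h𝒜, smul_eq_mul]
    refine Eq.trans ?_ this
    have hs : ∀ n, MeasurableSet {ω' | Φ n ω' ∈ B ∧
        config (fun m ω'' => Φ m ω'' - Φ n ω'') ω' ∈ 𝒜} := fun n =>
      (hΦ n hB).inter (hm n h𝒜)
    rw [Measure.sum_apply _ h𝒜, lintegral_tsum
      fun n => (measurable_const.indicator (hs n)).aemeasurable]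
    refine tsum_congr fun n => ?_
    rw [Measure.map_apply (hm n) h𝒜, Measure.restrict_apply (hm n h𝒜),
      lintegral_indicator_const (hs n), one_mul, inter_comm]
    rfl
  have := congrArg (fun μ => ∫⁻ ν, F ν ∂μ) heq
  simp only [lintegral_sum_measure, lintegral_smul_measure, smul_eq_mul] at this
  rw [lintegral_map hF (measurable_config h.measurable)] at this
  have hmn : ∀ n, Measurable fun ω => B.indicator (1 : Plane → ℝ≥0∞) (Φ n ω)
      * F (config (fun m ω' => Φ m ω' - Φ n ω') ω) := fun n =>
    ((measurable_one.indicator hB).comp (hΦ n)).mul (hF.comp (hm n))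
  rw [← this, lintegral_tsum fun n => (hmn n).aemeasurable]
  refine tsum_congr fun n => ?_
  rw [lintegral_map hF (hm n), ← lintegral_indicator (hΦ n hB)]
  refine lintegral_congr fun ω => ?_
  by_cases hω : Φ n ω ∈ B
  · rw [indicator_of_mem hω, indicator_of_mem (by exact hω), Pi.one_apply, one_mul]
  · rw [indicator_of_notMem hω, indicator_of_notMem (by exact hω), zero_mul]

/-- For points x of Φ in a small ball B, the translate w(· - x) lies within η 1_K of w. Replacing it
by w ∓ η 1_K removes the dependence on x, and the Campbell-Mecke formula evaluates the sum. On B the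
weight e^{-w} is close to e^{-w(0)}, which is the contribution of the typical point. Cancelling λ
|B| and letting η tend to 0 gives both inequalities. -/
lemma lintegral_eNeg_tsum_of_hasCompactSupport [IsProbabilityMeasure P₀] [IsProbabilityMeasure P]
    (h : IsPalmVersion lam Φ P₀ X P) (hΦ : IsHomogeneousPPP lam Φ P₀) (hlam : 0 < lam)
    {w : Plane → ℝ≥0} (hw : Continuous w) (hc : HasCompactSupport w) :
    ∫⁻ ω, eNeg (∑' n, w (X n ω)) ∂P
      = eNeg (w 0) * eNeg (ENNReal.ofReal lam * ∫⁻ y, (1 - eNeg (w y))) := by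
  obtain ⟨R, hR⟩ := exists_ball_translate_le hw hc
  set K := Metric.closedBall (0 : Plane) R with hK
  have hKm : MeasurableSet K := Metric.isClosed_closedBall.measurableSet
  have hwm : Measurable fun y => (w y : ℝ≥0∞) := hw.measurable.coe_nnreal_ennreal
  set l := ENNReal.ofReal lam with hl
  have hl0 : l ≠ 0 := by simpa [hl] using hlam
  have hlt : l ≠ ∞ := ENNReal.ofReal_ne_top
  set v := volume K with hv
  have hvt : v ≠ ∞ := measure_closedBall_lt_top.ne
  set A := ∫⁻ y, (1 - eNeg (w y)) with hA
  set Q := ∫⁻ ω, eNeg (∑' n, w (X n ω)) ∂P with hQ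
  -- The total error in the exponent is (2 + l v) η: one η for replacing w by ψ on B, one for
  -- replacing w(y) by w(0), and l v η in the integral over the plane.
  have hct : (2 + l * v : ℝ≥0∞) ≠ ∞ := by finiteness
  have hQt : Q ≠ ∞ := ((lintegral_mono (g := fun _ => 1) fun y => eNeg_le_one _).trans_lt
    (by simp)).ne
  have hindint : ∀ η : ℝ≥0, ∫⁻ y, K.indicator (fun _ => (η : ℝ≥0∞)) y = η * v := fun η =>
    lintegral_indicator_const hKm _
  have hindle : ∀ (η : ℝ≥0) y, K.indicator (fun _ => (η : ℝ≥0∞)) y ≤ η := fun η y =>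
    indicator_le_self' (fun _ _ => zero_le) y
  have hpalm : ∀ B, MeasurableSet B → ∫⁻ ω, ∑' n, B.indicator 1 (Φ n ω)
      * eNeg (∑' m, w (Φ m ω - Φ n ω)) ∂P₀ = l * volume B * Q := fun B hB => by
    have := h.lintegral_palm hΦ.measurable hB (F := fun μ => eNeg (∫⁻ y, w y ∂μ))
      (measurable_eNeg.comp (Measure.measurable_lintegral hwm))
    simpa only [lintegral_config hwm] using this
  have hcount : ∀ B, MeasurableSet B → volume B ≠ ∞ → ∀ ψ : Plane → ℝ≥0∞, Measurable ψ →
      ∫⁻ ω, ∑' n, B.indicator 1 (Φ n ω) * eNeg (∑' m, ψ (Φ m ω)) ∂P₀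
        = l * (∫⁻ y in B, eNeg (ψ y)) * eNeg (l * ∫⁻ y, (1 - eNeg (ψ y))) := by
    intro B hB hBt ψ hψ
    rw [← hΦ.lintegral_count_mul_eNeg hlam.le hψ hB hBt]
    refine lintegral_congr fun ω => ?_
    rw [ENNReal.tsum_mul_right, lintegral_config hψ, ← lintegral_indicator_one hB,
      lintegral_config (measurable_one.indicator hB)]
  apply le_antisymm
  · refine le_of_forall_mul_eNeg_le hQt hct fun η hη => ?_
    obtain ⟨r, hr, hball⟩ := hR η hη
    set B := Metric.ball (0 : Plane) r with hB
    have hBm : MeasurableSet B := Metric.isOpen_ball.measurableSet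
    have hB0 : volume B ≠ 0 := (Metric.measure_ball_pos _ _ hr).ne'
    have hBt : volume B ≠ ∞ := measure_ball_lt_top.ne
    -- The subtraction is truncated at 0, but ψ + η 1_K ≥ w still holds, and this is the only bound
    -- used in the comparison.
    set ψ : Plane → ℝ≥0∞ := fun y => w y - K.indicator (fun _ => (η : ℝ≥0∞)) y with hψ
    have hψm : Measurable ψ := hwm.sub (measurable_const.indicator hKm)
    have h1 : l * volume B * Q
        ≤ l * (∫⁻ y in B, eNeg (ψ y)) * eNeg (l * ∫⁻ y, (1 - eNeg (ψ y))) := by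
      rw [← hpalm B hBm, ← hcount B hBm hBt ψ hψm]
      refine lintegral_mono fun ω => ENNReal.tsum_le_tsum fun n => ?_
      by_cases hn : Φ n ω ∈ B
      · gcongr
        refine eNeg_antitone (ENNReal.tsum_le_tsum fun m => ?_)
        exact tsub_le_iff_right.2 (hball _ hn _).2
      · simp [indicator_of_notMem hn]
    have h2 : (∫⁻ y in B, eNeg (ψ y)) * eNeg (2 * η) ≤ volume B * eNeg (w 0) := by
      rw [← lintegral_mul_const (f := fun y => eNeg (ψ y)) _ (measurable_eNeg.comp hψm)]
      refine (setLIntegral_mono measurable_const fun y hy => ?_).trans_eq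
        ((setLIntegral_const B (eNeg (w 0))).trans (mul_comm _ _))
      rw [← eNeg_add]
      refine eNeg_antitone ?_
      have h3 := (hball y hy y).1
      rw [sub_self] at h3
      calc (w 0 : ℝ≥0∞) ≤ w y + K.indicator (fun _ => (η : ℝ≥0∞)) y := h3
        _ ≤ (ψ y + K.indicator (fun _ => (η : ℝ≥0∞)) y) + K.indicator (fun _ => (η : ℝ≥0∞)) y := by
            gcongr; exact le_tsub_add
        _ ≤ (ψ y + η) + η := by gcongr <;> exact hindle η y
        _ = ψ y + 2 * η := by ring
    have h4 : eNeg (l * ∫⁻ y, (1 - eNeg (ψ y))) * eNeg (l * (η * v)) ≤ eNeg (l * A) := by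
      rw [← eNeg_add, ← mul_add, ← hindint η,
        ← lintegral_add_right _ (measurable_const.indicator hKm)]
      refine eNeg_antitone ?_
      gcongr
      refine lintegral_mono fun y => ?_
      exact one_sub_eNeg_le_add le_tsub_add
    have heta : (2 + l * v) * η = 2 * η + l * (η * v) := by ring
    have h5 : l * volume B * (Q * eNeg ((2 + l * v) * η))
        ≤ l * volume B * (eNeg (w 0) * eNeg (l * A)) := by
      calc l * volume B * (Q * eNeg ((2 + l * v) * η))
          = l * volume B * Q * (eNeg (2 * η) * eNeg (l * (η * v))) := by
            rw [heta, eNeg_add]; ring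
        _ ≤ l * (∫⁻ y in B, eNeg (ψ y)) * eNeg (l * ∫⁻ y, (1 - eNeg (ψ y)))
            * (eNeg (2 * η) * eNeg (l * (η * v))) := by gcongr
        _ = l * ((∫⁻ y in B, eNeg (ψ y)) * eNeg (2 * η))
            * (eNeg (l * ∫⁻ y, (1 - eNeg (ψ y))) * eNeg (l * (η * v))) := by ring
        _ ≤ l * (volume B * eNeg (w 0)) * eNeg (l * A) := by gcongr
        _ = _ := by ring
    exact (ENNReal.mul_le_mul_iff_right (mul_ne_zero hl0 hB0) (ENNReal.mul_ne_top hlt hBt)).1 h5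
  · refine le_of_forall_mul_eNeg_le (ENNReal.mul_ne_top (eNeg_ne_top _) (eNeg_ne_top _)) hct
      fun η hη => ?_
    obtain ⟨r, hr, hball⟩ := hR η hη
    set B := Metric.ball (0 : Plane) r with hB
    have hBm : MeasurableSet B := Metric.isOpen_ball.measurableSet
    have hB0 : volume B ≠ 0 := (Metric.measure_ball_pos _ _ hr).ne'
    have hBt : volume B ≠ ∞ := measure_ball_lt_top.ne
    set ψ : Plane → ℝ≥0∞ := fun y => w y + K.indicator (fun _ => (η : ℝ≥0∞)) y with hψ
    have hψm : Measurable ψ := hwm.add (measurable_const.indicator hKm)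
    have h1 : l * (∫⁻ y in B, eNeg (ψ y)) * eNeg (l * ∫⁻ y, (1 - eNeg (ψ y)))
        ≤ l * volume B * Q := by
      rw [← hpalm B hBm, ← hcount B hBm hBt ψ hψm]
      refine lintegral_mono fun ω => ENNReal.tsum_le_tsum fun n => ?_
      by_cases hn : Φ n ω ∈ B
      · gcongr
        exact eNeg_antitone (ENNReal.tsum_le_tsum fun m => (hball _ hn _).1)
      · simp [indicator_of_notMem hn]
    have h2 : volume B * eNeg (w 0) * eNeg (2 * η) ≤ ∫⁻ y in B, eNeg (ψ y) := by
      rw [mul_assoc, ← eNeg_add]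
      refine ((setLIntegral_const B _).trans (mul_comm _ _)).symm.trans_le
        (setLIntegral_mono (measurable_eNeg.comp hψm) fun y hy => eNeg_antitone ?_)
      have h3 := (hball y hy y).2
      rw [sub_self] at h3
      calc ψ y ≤ (w 0 + K.indicator (fun _ => (η : ℝ≥0∞)) y)
            + K.indicator (fun _ => (η : ℝ≥0∞)) y := by simp only [hψ]; gcongr
        _ ≤ (w 0 + η) + η := by gcongr <;> exact hindle η y
        _ = w 0 + 2 * η := by ring
    have h4 : eNeg (l * A) * eNeg (l * (η * v)) ≤ eNeg (l * ∫⁻ y, (1 - eNeg (ψ y))) := by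
      rw [← eNeg_add, ← mul_add, ← hindint η,
        ← lintegral_add_right _ (measurable_const.indicator hKm)]
      refine eNeg_antitone ?_
      gcongr with y
      exact one_sub_eNeg_le_add le_rfl
    have heta : (2 + l * v) * η = 2 * η + l * (η * v) := by ring
    have h5 : l * volume B * (eNeg (w 0) * eNeg (l * A) * eNeg ((2 + l * v) * η))
        ≤ l * volume B * Q := by
      calc l * volume B * (eNeg (w 0) * eNeg (l * A) * eNeg ((2 + l * v) * η))
          = l * volume B * (eNeg (w 0) * eNeg (l * A) * (eNeg (2 * η) * eNeg (l * (η * v)))) := by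
            rw [heta, eNeg_add]
        _ = l * (volume B * eNeg (w 0) * eNeg (2 * η))
            * (eNeg (l * A) * eNeg (l * (η * v))) := by ring
        _ ≤ l * (∫⁻ y in B, eNeg (ψ y)) * eNeg (l * ∫⁻ y, (1 - eNeg (ψ y))) := by gcongr
        _ ≤ _ := h1
    exact (ENNReal.mul_le_mul_iff_right (mul_ne_zero hl0 hB0) (ENNReal.mul_ne_top hlt hBt)).1 h5

/-- The typical point sits at the origin and contributes the factor e^{-w(0)}, which can be
cancelled because w(0) is finite. -/
lemma reduced_laplace_of_hasCompactSupport [IsProbabilityMeasure P₀] [IsProbabilityMeasure P]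
    (h : IsPalmVersion lam Φ P₀ X P) (hΦ : IsHomogeneousPPP lam Φ P₀) (hlam : 0 < lam)
    {w : Plane → ℝ≥0} (hw : Continuous w) (hc : HasCompactSupport w) :
    ∫⁻ ω, eNeg (∑' n : {n : ℕ // n ≠ 0}, w (X n ω)) ∂P
      = eNeg (ENNReal.ofReal lam * ∫⁻ y, (1 - eNeg (w y))) := by
  have h1 := h.lintegral_eNeg_tsum_of_hasCompactSupport hΦ hlam hw hc
  have hm : Measurable fun ω => eNeg (∑' n : {n : ℕ // n ≠ 0}, w (X n ω)) :=
    measurable_eNeg.comp (Measurable.tsum fun n =>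
      (hw.measurable.comp (h.measurable n)).coe_nnreal_ennreal)
  have h2 : ∫⁻ ω, eNeg (∑' n, w (X n ω)) ∂P
      = eNeg (w 0) * ∫⁻ ω, eNeg (∑' n : {n : ℕ // n ≠ 0}, w (X n ω)) ∂P := by
    rw [← lintegral_const_mul _ hm]
    refine lintegral_congr_ae ?_
    filter_upwards [h.typical_at_origin] with ω hω
    rw [tsum_eq_add_tsum_ne_zero fun n => (w (X n ω) : ℝ≥0∞), eNeg_add, hω]
  rw [h2] at h1
  exact (ENNReal.mul_right_inj (eNeg_ne_zero ENNReal.coe_ne_top) (eNeg_ne_top _)).1 h1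

/-- Slivnyak's theorem for Laplace functionals: without its typical point, the Palm version of a
Poisson configuration has the Laplace functional of the Poisson configuration. -/
theorem reduced_laplace [IsProbabilityMeasure P₀] [IsProbabilityMeasure P]
    (h : IsPalmVersion lam Φ P₀ X P) (hΦ : IsHomogeneousPPP lam Φ P₀) (hlam : 0 < lam)
    {w : Plane → ℝ≥0} (hw : Continuous w) :
    ∫⁻ ω, eNeg (∑' n : {n : ℕ // n ≠ 0}, w (X n ω)) ∂P
      = eNeg (ENNReal.ofReal lam * ∫⁻ y, (1 - eNeg (w y))) := by
  -- Continuous cutoffs of w: zero outside the ball of radius k, equal to w where ‖y‖ + 1 ≤ k, and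
  -- increasing in k.
  let f : ℕ → Plane → ℝ≥0 := fun k y => w y * min 1 (Real.toNNReal (k - ‖y‖))
  have hf : ∀ k, Continuous (f k) := fun k => by
    refine hw.mul (continuous_const.min (continuous_real_toNNReal.comp ?_))
    fun_prop
  have hfc : ∀ k, HasCompactSupport (f k) := fun k => by
    refine HasCompactSupport.intro (isCompact_closedBall (0 : Plane) k) fun y hy => ?_
    rw [mem_closedBall_zero_iff, not_le] at hy
    simp only [f]
    rw [Real.toNNReal_of_nonpos (by linarith)]
    simp
  have hmono : ∀ y, Monotone fun k => f k y := fun y k m hkm => by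
    simp only [f]
    gcongr
  have hlim : ∀ y, Filter.Tendsto (fun k => (f k y : ℝ≥0∞)) Filter.atTop (nhds (w y)) := fun y => by
    refine tendsto_const_nhds.congr' ?_
    obtain ⟨m, hm⟩ := exists_nat_gt (‖y‖ + 1)
    filter_upwards [Filter.eventually_ge_atTop m] with k hk
    have hk' : (m : ℝ) ≤ k := by exact_mod_cast hk
    simp only [f]
    rw [min_eq_left, mul_one]
    rw [Real.le_toNNReal_iff_coe_le (by linarith)]
    push_cast
    linarith
  have hL : Filter.Tendsto (fun k => ∫⁻ ω, eNeg (∑' n : {n : ℕ // n ≠ 0}, f k (X n ω)) ∂P)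
      Filter.atTop (nhds (∫⁻ ω, eNeg (∑' n : {n : ℕ // n ≠ 0}, w (X n ω)) ∂P)) := by
    refine tendsto_lintegral_of_dominated_convergence (fun _ => 1)
      (fun k => measurable_eNeg.comp (Measurable.tsum fun n =>
        ((hf k).measurable.comp (h.measurable n)).coe_nnreal_ennreal))
      (fun n => .of_forall fun _ => eNeg_le_one _) (by simp) (.of_forall fun ω => ?_)
    refine (continuous_eNeg.tendsto _).comp ?_
    -- Sums become integrals for the counting measure, so that monotone convergence applies.
    simp_rw [← lintegral_count]
    exact lintegral_tendsto_of_tendsto_of_monotone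
      (fun k => Measurable.of_discrete.aemeasurable)
      (.of_forall fun n k m hkm => ENNReal.coe_le_coe.2 (hmono _ hkm))
      (.of_forall fun n => hlim _)
  have hR : Filter.Tendsto (fun k => eNeg (ENNReal.ofReal lam * ∫⁻ y, (1 - eNeg (f k y))))
      Filter.atTop (nhds (eNeg (ENNReal.ofReal lam * ∫⁻ y, (1 - eNeg (w y))))) := by
    refine (continuous_eNeg.tendsto _).comp (ENNReal.Tendsto.const_mul ?_
      (Or.inr ENNReal.ofReal_ne_top))
    refine lintegral_tendsto_of_tendsto_of_monotone
      (fun k => ((measurable_eNeg.comp (hf k).measurable.coe_nnreal_ennreal).const_sub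
        1).aemeasurable)
      (.of_forall fun y k m hkm => tsub_le_tsub_left
        (eNeg_antitone (ENNReal.coe_le_coe.2 (hmono y hkm))) 1)
      (.of_forall fun y => ?_)
    exact ENNReal.Tendsto.sub tendsto_const_nhds ((continuous_eNeg.tendsto _).comp (hlim y))
      (Or.inl ENNReal.one_ne_top)
  simp_rw [fun k => h.reduced_laplace_of_hasCompactSupport hΦ hlam (hf k) (hfc k)] at hL
  exact tendsto_nhds_unique hL hR

end IsPalmVersion

/-! ### Averaging over independent marked clusters. -/

section Independence

variable {Ω : Type*} [MeasurableSpace Ω] {P : Measure Ω} [IsProbabilityMeasure P]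

lemma lintegral_comp_of_indepFun {α β : Type*} [MeasurableSpace α] [MeasurableSpace β]
    {A : Ω → α} {B : Ω → β} (h : IndepFun A B P) (hA : Measurable A) (hB : Measurable B)
    {F : α × β → ℝ≥0∞} (hF : Measurable F) :
    ∫⁻ ω, F (A ω, B ω) ∂P = ∫⁻ ω, ∫⁻ ω', F (A ω, B ω') ∂P ∂P := by
  have := Measure.isProbabilityMeasure_map (μ := P) hB.aemeasurable
  rw [← lintegral_map (f := F) (g := fun ω => (A ω, B ω)) hF (hA.prodMk hB),
    (indepFun_iff_map_prod_eq_prod_map_map hA.aemeasurable hB.aemeasurable).1 h,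
    lintegral_prod _ hF.aemeasurable, lintegral_map hF.lintegral_prod_right' hA]
  exact lintegral_congr fun ω => lintegral_map (hF.comp measurable_prodMk_left) hB

variable {E U : Type*} [MeasurableSpace E] [MeasurableSpace U]

lemma measurable_prod_range_comp {α : Type*} [MeasurableSpace α] {s : α → ℕ} (hs : Measurable s)
    {f : ℕ → α → ℝ≥0∞} (hf : ∀ k, Measurable (f k)) :
    Measurable fun a => ∏ k ∈ Finset.range (s a), f k a := by
  have : Measurable fun q : ℕ × α => ∏ k ∈ Finset.range q.1, f k q.2 :=
    measurable_from_prod_countable_right fun n =>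
      Finset.measurable_prod (Finset.range n) fun k _ => hf k
  exact this.comp (hs.prodMk measurable_id)

/-- Expectation of a product over marked clusters: given the centres `X`, the clusters are
independent, with i.i.d. sizes `S` and i.i.d. marks `M`. -/
lemma lintegral_prod_clusters {X : ℕ → Ω → E} {S : ℕ → Ω → ℕ} {M : ℕ × ℕ → Ω → U}
    (hX : ∀ n, Measurable (X n)) (hS : ∀ n, Measurable (S n)) (hM : ∀ i, Measurable (M i))
    {sizeLaw : Measure ℕ} {markLaw : Measure U} (hSlaw : ∀ n, HasLaw (S n) sizeLaw P)
    (hMlaw : ∀ i, HasLaw (M i) markLaw P) (hSi : iIndepFun S P) (hMi : iIndepFun M P)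
    (hSM : IndepFun (fun ω n => S n ω) (fun ω i => M i ω) P)
    (hXSM : IndepFun (fun ω n => X n ω) (fun ω => (fun n => S n ω, fun i => M i ω)) P)
    {ξ : E → U → ℝ≥0∞} (hξ : Measurable (Function.uncurry ξ)) (T : Finset ℕ) :
    ∫⁻ ω, ∏ n ∈ T, ∏ k ∈ Finset.range (S n ω), ξ (X n ω) (M (n, k) ω) ∂P
      = ∫⁻ ω, ∏ n ∈ T, ∫⁻ k, (∫⁻ m, ξ (X n ω) m ∂markLaw) ^ k ∂sizeLaw ∂P := by
  classical
  have hXm : Measurable fun ω n => X n ω := measurable_pi_lambda _ hX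
  have hSm : Measurable fun ω n => S n ω := measurable_pi_lambda _ hS
  have hMm : Measurable fun ω i => M i ω := measurable_pi_lambda _ hM
  have hF : Measurable fun a : (ℕ → E) × (ℕ → ℕ) × (ℕ × ℕ → U) =>
      ∏ n ∈ T, ∏ k ∈ Finset.range (a.2.1 n), ξ (a.1 n) (a.2.2 (n, k)) := by
    refine Finset.measurable_prod _ fun n _ => ?_
    refine measurable_prod_range_comp (by fun_prop) fun k => ?_
    exact hξ.comp (f := fun a : (ℕ → E) × (ℕ → ℕ) × (ℕ × ℕ → U) => (a.1 n, a.2.2 (n, k)))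
      (by fun_prop)
  -- The centres are frozen first, then the sizes. Once both are fixed, the product runs over a
  -- deterministic finite set of users.
  refine (lintegral_comp_of_indepFun hXSM hXm (hSm.prodMk hMm) hF).trans
    (lintegral_congr fun ω₀ => ?_)
  have hF2 : Measurable fun a : (ℕ → ℕ) × (ℕ × ℕ → U) =>
      ∏ n ∈ T, ∏ k ∈ Finset.range (a.1 n), ξ (X n ω₀) (a.2 (n, k)) :=
    hF.comp (measurable_prodMk_left (x := fun n => X n ω₀))
  refine (lintegral_comp_of_indepFun hSM hSm hMm hF2).trans ?_
  have hξx : ∀ x, Measurable (ξ x) := fun x => hξ.comp measurable_prodMk_left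
  have hinner : ∀ s : ℕ → ℕ,
      ∫⁻ ω', ∏ n ∈ T, ∏ k ∈ Finset.range (s n), ξ (X n ω₀) (M (n, k) ω') ∂P
        = ∏ n ∈ T, (∫⁻ m, ξ (X n ω₀) m ∂markLaw) ^ s n := by
    intro s
    -- The labels of all users in the clusters of T, as one finite index set for the independent
    -- marks.
    let r : Finset (ℕ × ℕ) :=
      (T.sigma fun n => Finset.range (s n)).map (Equiv.sigmaEquivProd ℕ ℕ).toEmbedding
    have hr : ∀ q : ℕ × ℕ, q ∈ r ↔ q.1 ∈ T ∧ q.2 ∈ Finset.range (s q.1) := by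
      rintro ⟨n, k⟩
      simp [r]
    have h1 : ∀ ω', ∏ n ∈ T, ∏ k ∈ Finset.range (s n), ξ (X n ω₀) (M (n, k) ω')
        = ∏ q ∈ r, ξ (X q.1 ω₀) (M q ω') := fun ω' =>
      (Finset.prod_finset_product r T (fun n => Finset.range (s n)) hr
        (f := fun q => ξ (X q.1 ω₀) (M q ω'))).symm
    simp_rw [h1]
    have hi := hMi.comp (fun q => ξ (X q.1 ω₀)) (fun q => hξx _)
    refine (lintegral_prod_eq_prod_lintegral_of_indepFun r _ hi
      fun q => (hξx _).comp (hM q)).trans ?_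
    have h2 : ∀ q : ℕ × ℕ, ∫⁻ ω', ξ (X q.1 ω₀) (M q ω') ∂P
        = ∫⁻ m, ξ (X q.1 ω₀) m ∂markLaw := fun q =>
      (hMlaw q).lintegral_comp (hξx _).aemeasurable
    simp only [Function.comp_def, h2]
    rw [Finset.prod_finset_product r T (fun n => Finset.range (s n)) hr]
    simp
  simp only [hinner]
  have hi := hSi.comp (fun n k => (∫⁻ m, ξ (X n ω₀) m ∂markLaw) ^ k) fun n => .of_discrete
  refine (lintegral_prod_eq_prod_lintegral_of_indepFun T _ hi
    fun n => Measurable.of_discrete.comp (hS n)).trans ?_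
  exact Finset.prod_congr rfl fun n _ =>
    (hSlaw n).lintegral_comp (f := fun k => (∫⁻ m, ξ (X n ω₀) m ∂markLaw) ^ k)
      Measurable.of_discrete.aemeasurable

end Independence

lemma tsum_ne_zero_eq_tsum_succ (f : ℕ → ℝ≥0∞) :
    ∑' n : {n : ℕ // n ≠ 0}, f n = ∑' n, f (n + 1) := by
  let e : ℕ ≃ {n : ℕ // n ≠ 0} :=
    ⟨fun n => ⟨n + 1, n.succ_ne_zero⟩, fun n => n.1 - 1, fun n => by simp,
      fun n => Subtype.ext (Nat.succ_pred_eq_of_ne_zero n.2)⟩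
  exact (e.tsum_eq (fun n : {n : ℕ // n ≠ 0} => f n)).symm

/-- Exponentials of partial sums converge and are bounded by 1, so equality for finitely many
clusters passes to the limit, even where a sum is infinite. -/
lemma lintegral_eNeg_tsum_eq_of_partial_sums {Ω : Type*} [MeasurableSpace Ω] {P : Measure Ω}
    [IsProbabilityMeasure P] {f g : ℕ → Ω → ℝ≥0∞} (hf : ∀ n, Measurable (f n))
    (hg : ∀ n, Measurable (g n))
    (h : ∀ m, ∫⁻ ω, eNeg (∑ n ∈ Finset.range m, f n ω) ∂P
      = ∫⁻ ω, eNeg (∑ n ∈ Finset.range m, g n ω) ∂P) :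
    ∫⁻ ω, eNeg (∑' n, f n ω) ∂P = ∫⁻ ω, eNeg (∑' n, g n ω) ∂P := by
  have hlim : ∀ {f : ℕ → Ω → ℝ≥0∞}, (∀ n, Measurable (f n)) →
      Filter.Tendsto (fun m => ∫⁻ ω, eNeg (∑ n ∈ Finset.range m, f n ω) ∂P) Filter.atTop
        (nhds (∫⁻ ω, eNeg (∑' n, f n ω) ∂P)) := fun {f} hf =>
    tendsto_lintegral_of_dominated_convergence (fun _ => 1)
      (fun m => measurable_eNeg.comp (Finset.measurable_sum _ fun n _ => hf n))
      (fun n => .of_forall fun _ => eNeg_le_one _) (by simp)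
      (.of_forall fun ω => (continuous_eNeg.tendsto _).comp (ENNReal.tendsto_nat_tsum _))
  refine tendsto_nhds_unique (hlim hf) ?_
  simp_rw [h]
  exact hlim hg

/-! ### Reduction of the interference to a functional of the centres. -/

namespace UplinkParams

variable (p : UplinkParams)

/-- The channel gain to the origin of a user with mark `m` in the cluster centred at `x`. -/
noncomputable def markGain (x : Plane) (m : Plane × ℝ × ℝ × ℝ × ℝ) : ℝ :=
  if m.2.1 < p.prob .los (p.γ ‖x + m.1‖) then
    p.pathLoss .los ‖x + m.1‖ * m.2.2.2.2 * m.2.2.1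
  else
    p.pathLoss .nlos ‖x + m.1‖ * m.2.2.2.2 * m.2.2.2.1

lemma measurable_γ : Measurable p.γ :=
  Nat.measurable_floor.comp (measurable_id.mul_const _)

lemma measurable_pathLoss (κ : LinkState) : Measurable (p.pathLoss κ) := by
  unfold pathLoss
  fun_prop

lemma measurable_prob_γ (κ : LinkState) : Measurable fun r => p.prob κ (p.γ r) :=
  (Measurable.of_discrete (f := p.prob κ)).comp p.measurable_γ

lemma measurable_markGain : Measurable (Function.uncurry p.markGain) := by
  have hr : Measurable fun a : Plane × Plane × ℝ × ℝ × ℝ × ℝ => ‖a.1 + a.2.1‖ := by fun_prop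
  have hL := (p.measurable_pathLoss .los).comp hr
  have hN := (p.measurable_pathLoss .nlos).comp hr
  refine Measurable.ite (measurableSet_lt ?_ ((p.measurable_prob_γ .los).comp hr)) ?_ ?_
  · fun_prop
  · exact (hL.mul (by fun_prop)).mul (by fun_prop)
  · exact (hN.mul (by fun_prop)).mul (by fun_prop)

/-- The Laplace transform at `s` of the channel gain of a user of the cluster centred at `x`. -/
noncomputable def userLaplace (s : ℝ) (x : Plane) : ℝ≥0∞ :=
  ∫⁻ m, eNeg (ENNReal.ofReal s * ENNReal.ofReal (p.markGain x m)) ∂p.userLaw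

end UplinkParams

namespace UplinkNetwork

variable {p : UplinkParams} {Ω₀ Ω : Type*} [MeasurableSpace Ω₀] [MeasurableSpace Ω]
  {Φ : ℕ → Ω₀ → Plane} {P₀ : Measure Ω₀} {sizeLaw : Measure ℕ} {P : Measure Ω}
  (N : UplinkNetwork p Φ P₀ sizeLaw P)

/-- Everything attached to the user `i.2` of the cluster `i.1`. -/
def mark (i : ℕ × ℕ) (ω : Ω) : Plane × ℝ × ℝ × ℝ × ℝ :=
  (N.offset i.1 i.2 ω, N.block i.1 i.2 ω, N.fadeLos i.1 i.2 ω, N.fadeNlos i.1 i.2 ω,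
    N.gain i.1 i.2 ω)

lemma measurable_mark (i : ℕ × ℕ) : Measurable (N.mark i) :=
  (N.measurable_offset _ _).prodMk ((N.measurable_block _ _).prodMk
    ((N.measurable_fadeLos _ _).prodMk ((N.measurable_fadeNlos _ _).prodMk
      (N.measurable_gain _ _))))

lemma measurable_channelGain (n k : ℕ) : Measurable (N.channelGain n k) :=
  p.measurable_markGain.comp ((N.palm.measurable n).prodMk (N.measurable_mark (n, k)))

/-- The interference from one cluster. -/
noncomputable def clusterInterference (n : ℕ) (ω : Ω) : ℝ≥0∞ :=
  ∑ k ∈ Finset.range (N.size n ω), ENNReal.ofReal (N.channelGain n k ω)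

lemma measurable_clusterInterference (n : ℕ) : Measurable (N.clusterInterference n) := by
  have : Measurable fun q : ℕ × Ω =>
      ∑ k ∈ Finset.range q.1, ENNReal.ofReal (N.channelGain n k q.2) :=
    measurable_from_prod_countable_right fun m => Finset.measurable_sum (Finset.range m) fun k _ =>
      (N.measurable_channelGain n k).ennreal_ofReal
  exact this.comp ((N.measurable_size n).prodMk measurable_id)

/-- Integrating out sizes and marks replaces each cluster by the deterministic weight w at its
centre. -/
lemma lintegral_eNeg_interInterference [IsProbabilityMeasure P] (s : ℝ) {w : Plane → ℝ≥0}
    (hw : Measurable w)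
    (hws : ∀ x, ∫⁻ k, p.userLaplace s x ^ k ∂sizeLaw = eNeg (w x)) :
    ∫⁻ ω, eNeg (ENNReal.ofReal s * N.interInterference ω) ∂P
      = ∫⁻ ω, eNeg (∑' n : {n : ℕ // n ≠ 0}, w (N.parent n ω)) ∂P := by
  have h1 : ∀ ω, ENNReal.ofReal s * N.interInterference ω
      = ∑' n, ENNReal.ofReal s * N.clusterInterference (n + 1) ω := fun ω => by
    rw [ENNReal.tsum_mul_left]
    exact congrArg _ (tsum_ne_zero_eq_tsum_succ fun n => N.clusterInterference n ω)
  simp_rw [h1, fun ω => tsum_ne_zero_eq_tsum_succ fun n => (w (N.parent n ω) : ℝ≥0∞)]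
  refine lintegral_eNeg_tsum_eq_of_partial_sums
    (fun n => (N.measurable_clusterInterference _).const_mul _)
    (fun n => (hw.comp (N.palm.measurable _)).coe_nnreal_ennreal) fun m => ?_
  have h2 := lintegral_prod_clusters N.palm.measurable N.measurable_size N.measurable_mark
    N.size_law (fun i => N.user_law i.1 i.2) N.size_indep N.user_indep N.size_user_indep
    N.parent_indep (ξ := fun x m => eNeg (ENNReal.ofReal s * ENNReal.ofReal (p.markGain x m)))
    (measurable_eNeg.comp (p.measurable_markGain.ennreal_ofReal.const_mul _))
    -- The shift by one leaves out the cluster of index 0, that of the typical UAV.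
    ((Finset.range m).map (addRightEmbedding 1))
  simp only [Finset.prod_map, addRightEmbedding_apply, ← eNeg_sum, ← Finset.mul_sum] at h2
  simp only [← Finset.mul_sum]
  refine h2.trans (lintegral_congr fun ω => ?_)
  rw [eNeg_sum]
  exact Finset.prod_congr rfl fun n _ => hws _

lemma laplaceInter_eq [IsProbabilityMeasure P] (s : ℝ) :
    N.laplaceInter s
      = (∫⁻ ω, eNeg (ENNReal.ofReal s * N.interInterference ω) ∂P).toReal := by
  have hm : Measurable fun ω => ENNReal.ofReal s * N.interInterference ω := by
    have : Measurable fun ω => ∑' n : {n : ℕ // n ≠ 0}, N.clusterInterference n ω :=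
      Measurable.tsum fun n => N.measurable_clusterInterference n
    exact this.const_mul _
  have hme : Measurable expNeg := by
    have : expNeg = fun x => (eNeg x).toReal := funext fun x => (toReal_eNeg x).symm
    rw [this]
    exact measurable_eNeg.ennreal_toReal
  rw [laplaceInter, integral_eq_lintegral_of_nonneg_ae (.of_forall fun ω => expNeg_nonneg _)
    (hme.comp hm).aestronglyMeasurable]
  simp_rw [eNeg_eq_ofReal_expNeg]

end UplinkNetwork

/-! ### The Laplace transform of a single link. -/

/-- The Laplace transform of the Gamma distribution. -/
lemma lintegral_eNeg_gammaMeasure {a r t : ℝ} (ha : 0 < a) (hr : 0 < r) (ht : 0 ≤ t) :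
    ∫⁻ x, eNeg (ENNReal.ofReal (t * x)) ∂gammaMeasure a r
      = ENNReal.ofReal ((1 + t / r) ^ (-a)) := by
  have hm : Measurable fun x : ℝ => eNeg (ENNReal.ofReal (t * x)) :=
    measurable_eNeg.comp (by fun_prop)
  have hpdf : ∀ b : ℝ, Measurable (gammaPDF a b) := fun b =>
    (measurable_gammaPDFReal a b).ennreal_ofReal
  rw [gammaMeasure, lintegral_withDensity_eq_lintegral_mul _ (hpdf r) hm]
  -- The factor e^{-tx} turns the rate r into r + t; the ratio of the normalizing constants is (r /
  -- (r + t))^a.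
  have h : ∀ x, (gammaPDF a r * fun x : ℝ => eNeg (ENNReal.ofReal (t * x))) x
      = ENNReal.ofReal ((1 + t / r) ^ (-a)) * gammaPDF a (r + t) x := by
    intro x
    rw [Pi.mul_apply]
    rcases lt_or_ge x 0 with hx | hx
    · simp [gammaPDF_of_neg hx]
    · rw [gammaPDF_of_nonneg hx, gammaPDF_of_nonneg hx, eNeg_ofReal (by positivity),
        ← ENNReal.ofReal_mul (by positivity), ← ENNReal.ofReal_mul (by positivity)]
      congr 1
      have h1 : (1 + t / r) ^ (-a) * (r + t) ^ a = r ^ a := by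
        rw [Real.rpow_neg (by positivity), show r + t = r * (1 + t / r) by field_simp,
          Real.mul_rpow hr.le (by positivity)]
        have : (1 + t / r) ^ a ≠ 0 := (Real.rpow_pos_of_pos (by positivity) a).ne'
        field_simp
      rw [← h1, show -((r + t) * x) = -(r * x) + -(t * x) by ring, Real.exp_add]
      ring
  simp_rw [h]
  rw [lintegral_const_mul _ (hpdf _), lintegral_gammaPDF_eq_one ha (by positivity), mul_one]

lemma lintegral_uniform_ite {q : ℝ} (hq0 : 0 ≤ q) (hq1 : q ≤ 1) (A B : ℝ≥0∞) :
    ∫⁻ b in Icc (0 : ℝ) 1, (if b < q then A else B)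
      = ENNReal.ofReal q * A + ENNReal.ofReal (1 - q) * B := by
  have h : ∀ b : ℝ, (if b < q then A else B)
      = (Iio q).indicator (fun _ => A) b + (Ici q).indicator (fun _ => B) b := fun b => by
    by_cases hb : b < q
    · simp [hb]
    · simp [hb, not_lt.1 hb]
  simp_rw [h]
  rw [lintegral_add_left (measurable_const.indicator measurableSet_Iio),
    lintegral_indicator_const measurableSet_Iio, lintegral_indicator_const measurableSet_Ici,
    Measure.restrict_apply measurableSet_Iio, Measure.restrict_apply measurableSet_Ici]
  have h1 : Iio q ∩ Icc (0 : ℝ) 1 = Ico 0 q := by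
    ext b; simp only [mem_inter_iff, mem_Iio, mem_Icc, mem_Ico]
    exact ⟨fun h => ⟨h.2.1, h.1⟩, fun h => ⟨h.2, h.1, (h.2.trans_le hq1).le⟩⟩
  have h2 : Ici q ∩ Icc (0 : ℝ) 1 = Icc q 1 := by
    ext b; simp only [mem_inter_iff, mem_Ici, mem_Icc]
    exact ⟨fun h => ⟨h.1, h.2.2⟩, fun h => ⟨h.1, hq0.trans h.1, h.2⟩⟩
  rw [h1, h2, Real.volume_Ico, Real.volume_Icc, sub_zero, mul_comm A, mul_comm B]

namespace UplinkParams

variable (p : UplinkParams)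

lemma probLos_mem (k : ℕ) : p.probLos k ∈ Icc (0 : ℝ) 1 := by
  unfold probLos
  split_ifs
  · simp
  · have h : ∀ x y : ℝ, 0 ≤ 1 - Real.exp (-(x ^ 2 / (2 * p.ε ^ 2 * y ^ 2))) ∧
        1 - Real.exp (-(x ^ 2 / (2 * p.ε ^ 2 * y ^ 2))) ≤ 1 := fun x y =>
      ⟨sub_nonneg.2 (Real.exp_le_one_iff.2 (neg_nonpos.2 (by positivity))),
        sub_le_self _ (Real.exp_nonneg _)⟩
    exact ⟨Finset.prod_nonneg fun n _ => (h _ _).1,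
      Finset.prod_le_one (fun n _ => (h _ _).1) fun n _ => (h _ _).2⟩

lemma prob_nonneg (κ : LinkState) (k : ℕ) : 0 ≤ p.prob κ k := by
  cases κ
  · exact (p.probLos_mem k).1
  · exact sub_nonneg.2 (p.probLos_mem k).2

variable {p} (hp : p.Admissible)
include hp

lemma gainProb_nonneg (i : Fin 4) : 0 ≤ p.gainProb i := by
  have key : ∀ x y : ℝ, x ∈ Icc 0 (2 * Real.pi) → y ∈ Icc 0 Real.pi →
      0 ≤ x / (2 * Real.pi) * (y / Real.pi) ∧ x / (2 * Real.pi) * (y / Real.pi) ≤ 1 := by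
    intro x y hx hy
    have hπ := Real.pi_pos
    have h1 : x / (2 * Real.pi) ≤ 1 := (div_le_one (by positivity)).2 hx.2
    have h2 : y / Real.pi ≤ 1 := (div_le_one hπ).2 hy.2
    have h3 : 0 ≤ x / (2 * Real.pi) := div_nonneg hx.1 (by positivity)
    have h4 : 0 ≤ y / Real.pi := div_nonneg hy.1 hπ.le
    exact ⟨mul_nonneg h3 h4, mul_le_one₀ h1 h4 h2⟩
  obtain ⟨a0, a1⟩ := key _ _ hp.θta_mem hp.θte_mem
  obtain ⟨b0, b1⟩ := key _ _ hp.θra_mem hp.θre_mem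
  fin_cases i
  · exact mul_nonneg a0 b0
  · exact mul_nonneg (sub_nonneg.2 a1) b0
  · exact mul_nonneg a0 (sub_nonneg.2 b1)
  · exact mul_nonneg (sub_nonneg.2 a1) (sub_nonneg.2 b1)

omit hp in
lemma sum_gainProb : ∑ i, p.gainProb i = 1 := by
  simp only [Fin.sum_univ_four, gainProb, Matrix.cons_val]
  ring

lemma gainValue_nonneg (i : Fin 4) : 0 ≤ p.gainValue i := by
  fin_cases i
  · exact mul_nonneg hp.Mt_nonneg hp.Mr_nonneg
  · exact mul_nonneg hp.mt_nonneg hp.Mr_nonneg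
  · exact mul_nonneg hp.Mt_nonneg hp.mr_nonneg
  · exact mul_nonneg hp.mt_nonneg hp.mr_nonneg

lemma isProbabilityMeasure_gainLaw : IsProbabilityMeasure p.gainLaw := by
  constructor
  simp only [gainLaw, Measure.finsetSum_apply, Measure.smul_apply, measure_univ, smul_eq_mul,
    mul_one]
  rw [← ENNReal.ofReal_sum_of_nonneg fun i _ => gainProb_nonneg hp i, sum_gainProb,
    ENNReal.ofReal_one]

lemma pathLoss_nonneg (κ : LinkState) (r : ℝ) : 0 ≤ p.pathLoss κ r :=
  div_nonneg (hp.C_pos κ).le (Real.sqrt_nonneg _)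

/-- The Laplace transform at `s` of the channel gain in state `κ` at distance `r`. -/
lemma lintegral_fading_gain {s : ℝ} (hs : 0 ≤ s) (κ : LinkState) (r : ℝ) :
    ∫⁻ f, ∫⁻ g, eNeg (ENNReal.ofReal s * ENNReal.ofReal (p.pathLoss κ r * g * f)) ∂p.gainLaw
        ∂gammaMeasure (p.nak κ) (p.nak κ)
      = ENNReal.ofReal (∑ i : Fin 4, p.gainProb i * (1 + s * p.C κ * p.gainValue i
          / (p.nak κ * Real.sqrt ((r ^ 2 + p.Δh ^ 2) ^ p.α κ))) ^ (-p.nak κ)) := by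
  have hm : ∀ f : ℝ, Measurable fun g : ℝ =>
      eNeg (ENNReal.ofReal s * ENNReal.ofReal (p.pathLoss κ r * g * f)) := fun f =>
    measurable_eNeg.comp (by fun_prop)
  have hm' : ∀ g : ℝ, Measurable fun f : ℝ =>
      eNeg (ENNReal.ofReal s * ENNReal.ofReal (p.pathLoss κ r * g * f)) := fun g =>
    measurable_eNeg.comp (by fun_prop)
  have hgain : ∀ f : ℝ,
      ∫⁻ g, eNeg (ENNReal.ofReal s * ENNReal.ofReal (p.pathLoss κ r * g * f)) ∂p.gainLaw
      = ∑ i : Fin 4, ENNReal.ofReal (p.gainProb i)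
        * eNeg (ENNReal.ofReal s * ENNReal.ofReal (p.pathLoss κ r * p.gainValue i * f)) := by
    intro f
    simp only [gainLaw, lintegral_finsetSum_measure, lintegral_smul_measure, smul_eq_mul]
    simp_rw [lintegral_dirac' _ (hm f)]
  simp_rw [hgain]
  have hnn : ∀ i, 0 ≤ 1 + s * p.C κ * p.gainValue i
      / (p.nak κ * Real.sqrt ((r ^ 2 + p.Δh ^ 2) ^ p.α κ)) := fun i =>
    add_nonneg zero_le_one (div_nonneg (mul_nonneg (mul_nonneg hs (hp.C_pos κ).le)
      (gainValue_nonneg hp i)) (mul_nonneg (hp.nak_pos κ).le (Real.sqrt_nonneg _)))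
  rw [lintegral_finsetSum _ fun i _ => (hm' _).const_mul _, ENNReal.ofReal_sum_of_nonneg
    fun i _ => mul_nonneg (gainProb_nonneg hp i) (Real.rpow_nonneg (hnn i) _)]
  refine Finset.sum_congr rfl fun i _ => ?_
  rw [lintegral_const_mul _ (hm' _), ENNReal.ofReal_mul (gainProb_nonneg hp i)]
  congr 1
  have h1 : ∀ f : ℝ, ENNReal.ofReal s * ENNReal.ofReal (p.pathLoss κ r * p.gainValue i * f)
      = ENNReal.ofReal (s * (p.pathLoss κ r * p.gainValue i) * f) := fun f => by
    rw [← ENNReal.ofReal_mul hs, mul_assoc s]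
  simp_rw [h1]
  rw [lintegral_eNeg_gammaMeasure (hp.nak_pos κ) (hp.nak_pos κ)
    (mul_nonneg hs (mul_nonneg (pathLoss_nonneg hp κ r) (gainValue_nonneg hp i)))]
  congr 3
  -- No nonvanishing is needed: at r = Δh = 0 both fractions are 0 because division by zero is 0.
  rw [pathLoss]
  ring

/-- `Λ^L + Λ^N` at distance `r`. -/
noncomputable def linkLaplace (p : UplinkParams) (s r : ℝ) : ℝ :=
  p.Λ .los (p.γ r) r s + p.Λ .nlos (p.γ r) r s

omit hp in
lemma measurable_linkLaplace (s : ℝ) : Measurable (p.linkLaplace s) := by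
  have h : ∀ κ, Measurable fun r => p.Λ κ (p.γ r) r s := fun κ => by
    unfold Λ
    exact (p.measurable_prob_γ κ).mul (by fun_prop)
  exact (h _).add (h _)

/-- The law of the marks of a user other than its displacement. -/
noncomputable def channelLaw (p : UplinkParams) : Measure (ℝ × ℝ × ℝ × ℝ) :=
  (volume.restrict (Icc (0 : ℝ) 1)).prod ((gammaMeasure (p.nak .los) (p.nak .los)).prod
    ((gammaMeasure (p.nak .nlos) (p.nak .nlos)).prod p.gainLaw))

lemma isProbabilityMeasure_channelLaw : IsProbabilityMeasure p.channelLaw := by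
  have := isProbabilityMeasure_gainLaw hp
  have := isProbabilityMeasure_gammaMeasure (hp.nak_pos .los) (hp.nak_pos .los)
  have := isProbabilityMeasure_gammaMeasure (hp.nak_pos .nlos) (hp.nak_pos .nlos)
  have : IsProbabilityMeasure (volume.restrict (Icc (0 : ℝ) 1)) := ⟨by simp⟩
  unfold channelLaw
  infer_instance

/-- The uniform variable selects the state with probabilities p_L and p_N. The fading of the other
state does not enter and integrates to 1. -/
lemma lintegral_channelLaw {s : ℝ} (hs : 0 ≤ s) (r : ℝ) :
    ∫⁻ m, eNeg (ENNReal.ofReal s * ENNReal.ofReal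
        (if m.1 < p.prob .los (p.γ r) then p.pathLoss .los r * m.2.2.2 * m.2.1
          else p.pathLoss .nlos r * m.2.2.2 * m.2.2.1)) ∂p.channelLaw
      = ENNReal.ofReal (p.linkLaplace s r) := by
  have := isProbabilityMeasure_gainLaw hp
  have := isProbabilityMeasure_gammaMeasure (hp.nak_pos .los) (hp.nak_pos .los)
  have := isProbabilityMeasure_gammaMeasure (hp.nak_pos .nlos) (hp.nak_pos .nlos)
  have hm : Measurable fun m : ℝ × ℝ × ℝ × ℝ => eNeg (ENNReal.ofReal s * ENNReal.ofReal
        (if m.1 < p.prob .los (p.γ r) then p.pathLoss .los r * m.2.2.2 * m.2.1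
          else p.pathLoss .nlos r * m.2.2.2 * m.2.2.1)) := by
    refine measurable_eNeg.comp ((Measurable.ennreal_ofReal ?_).const_mul _)
    exact Measurable.ite (measurableSet_lt measurable_fst measurable_const)
      (by fun_prop) (by fun_prop)
  rw [channelLaw, lintegral_prod _ hm.aemeasurable]
  have hinner : ∀ b : ℝ, ∫⁻ m : ℝ × ℝ × ℝ, eNeg (ENNReal.ofReal s * ENNReal.ofReal
        (if b < p.prob .los (p.γ r) then p.pathLoss .los r * m.2.2 * m.1
          else p.pathLoss .nlos r * m.2.2 * m.2.1))
        ∂((gammaMeasure (p.nak .los) (p.nak .los)).prod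
          ((gammaMeasure (p.nak .nlos) (p.nak .nlos)).prod p.gainLaw))
      = if b < p.prob .los (p.γ r) then
          ∫⁻ f, ∫⁻ g, eNeg (ENNReal.ofReal s * ENNReal.ofReal (p.pathLoss .los r * g * f))
            ∂p.gainLaw ∂gammaMeasure (p.nak .los) (p.nak .los)
        else
          ∫⁻ f, ∫⁻ g, eNeg (ENNReal.ofReal s * ENNReal.ofReal (p.pathLoss .nlos r * g * f))
            ∂p.gainLaw ∂gammaMeasure (p.nak .nlos) (p.nak .nlos) := by
    intro b
    have hF : ∀ κ, Measurable fun q : ℝ × ℝ =>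
        eNeg (ENNReal.ofReal s * ENNReal.ofReal (p.pathLoss κ r * q.1 * q.2)) := fun κ =>
      measurable_eNeg.comp (by fun_prop)
    split_ifs with hb
    · refine (lintegral_prod _ (((hF .los).comp (f := fun m : ℝ × ℝ × ℝ => (m.2.2, m.1))
        (by fun_prop)).aemeasurable)).trans ?_
      refine lintegral_congr fun f => ?_
      refine (lintegral_prod _ (((hF .los).comp (f := fun m : ℝ × ℝ => (m.2, f))
        (by fun_prop)).aemeasurable)).trans ?_
      simp
    · refine (lintegral_prod _ (((hF .nlos).comp (f := fun m : ℝ × ℝ × ℝ => (m.2.2, m.2.1))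
        (by fun_prop)).aemeasurable)).trans ?_
      simp only [Function.comp_def, lintegral_const, measure_univ, mul_one]
      exact lintegral_prod _ (((hF .nlos).comp (f := fun m : ℝ × ℝ => (m.2, m.1))
        (by fun_prop)).aemeasurable)
  simp_rw [hinner, lintegral_fading_gain hp hs]
  rw [lintegral_uniform_ite (q := p.prob .los (p.γ r)) (p.probLos_mem _).1 (p.probLos_mem _).2]
  have hnn : ∀ κ, 0 ≤ ∑ i : Fin 4, p.gainProb i * (1 + s * p.C κ * p.gainValue i
          / (p.nak κ * Real.sqrt ((r ^ 2 + p.Δh ^ 2) ^ p.α κ))) ^ (-p.nak κ) := fun κ =>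
    Finset.sum_nonneg fun i _ => mul_nonneg (gainProb_nonneg hp i) (Real.rpow_nonneg
      (add_nonneg zero_le_one (div_nonneg (mul_nonneg (mul_nonneg hs (hp.C_pos κ).le)
      (gainValue_nonneg hp i)) (mul_nonneg (hp.nak_pos κ).le (Real.sqrt_nonneg _)))) _)
  rw [show 1 - p.prob .los (p.γ r) = p.prob .nlos (p.γ r) from rfl,
    ← ENNReal.ofReal_mul (p.prob_nonneg _ _), ← ENNReal.ofReal_mul
    (p.prob_nonneg .nlos _), ← ENNReal.ofReal_add (mul_nonneg (p.prob_nonneg _ _) (hnn _))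
    (mul_nonneg (p.prob_nonneg .nlos _) (hnn _))]
  rfl

lemma ofReal_linkLaplace_le_one {s : ℝ} (hs : 0 ≤ s) (r : ℝ) :
    ENNReal.ofReal (p.linkLaplace s r) ≤ 1 := by
  have := isProbabilityMeasure_channelLaw hp
  rw [← lintegral_channelLaw hp hs r]
  exact (lintegral_mono (g := fun _ => 1) fun _ => eNeg_le_one _).trans_eq (by simp)

lemma linkLaplace_nonneg {s : ℝ} (hs : 0 ≤ s) (r : ℝ) : 0 ≤ p.linkLaplace s r := by
  have h : ∀ κ, 0 ≤ p.Λ κ (p.γ r) r s := fun κ => mul_nonneg (p.prob_nonneg _ _)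
    (Finset.sum_nonneg fun i _ => mul_nonneg (gainProb_nonneg hp i) (Real.rpow_nonneg
      (add_nonneg zero_le_one (div_nonneg (mul_nonneg (mul_nonneg hs (hp.C_pos κ).le)
      (gainValue_nonneg hp i)) (mul_nonneg (hp.nak_pos κ).le (Real.sqrt_nonneg _)))) _))
  exact add_nonneg (h _) (h _)

/-- Averaging over the blockage, the fading and the directivity gain. -/
lemma userLaplace_eq_lintegral_offsetLaw {s : ℝ} (hs : 0 ≤ s) (x : Plane) :
    p.userLaplace s x = ∫⁻ y, ENNReal.ofReal (p.linkLaplace s ‖x + y‖) ∂p.shape.offsetLaw := by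
  have := isProbabilityMeasure_channelLaw hp
  have hm : Measurable fun m => eNeg (ENNReal.ofReal s * ENNReal.ofReal (p.markGain x m)) := by
    have := p.measurable_markGain.comp (measurable_prodMk_left (x := x))
    exact measurable_eNeg.comp (this.ennreal_ofReal.const_mul _)
  have h : p.userLaplace s x = ∫⁻ y, ∫⁻ m, eNeg (ENNReal.ofReal s
      * ENNReal.ofReal (p.markGain x (y, m))) ∂p.channelLaw ∂p.shape.offsetLaw := by
    rw [userLaplace, userLaw, ← channelLaw, lintegral_prod _ hm.aemeasurable]
  rw [h]
  refine lintegral_congr fun y => ?_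
  rw [← lintegral_channelLaw hp hs]
  rfl

end UplinkParams

/-! ### The distance of a user from the origin -/

lemma integral_cos_pow_add_two_neg_pi_pi (n : ℕ) :
    ∫ θ in -Real.pi..Real.pi, Real.cos θ ^ (n + 2)
      = (n + 1) / (n + 2) * ∫ θ in -Real.pi..Real.pi, Real.cos θ ^ n := by
  rw [integral_cos_pow]
  simp

lemma integral_cos_pow_odd_neg_pi_pi (k : ℕ) :
    ∫ θ in -Real.pi..Real.pi, Real.cos θ ^ (2 * k + 1) = 0 := by
  induction k with
  | zero => simp
  | succ k ih =>
    rw [show 2 * (k + 1) + 1 = 2 * k + 1 + 2 by ring, integral_cos_pow_add_two_neg_pi_pi, ih,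
      mul_zero]

lemma integral_cos_pow_even_neg_pi_pi (k : ℕ) :
    ∫ θ in -Real.pi..Real.pi, Real.cos θ ^ (2 * k)
      = 2 * Real.pi * ((2 * k)! / (4 ^ k * (k ! : ℝ) ^ 2)) := by
  induction k with
  | zero => simp; ring
  | succ k ih =>
    rw [show 2 * (k + 1) = 2 * k + 2 by ring, integral_cos_pow_add_two_neg_pi_pi, ih,
      Nat.factorial_succ (2 * k + 1), Nat.factorial_succ (2 * k), Nat.factorial_succ k]
    push_cast
    field_simp
    ring

/-- The integral representation of the modified Bessel function of order zero. -/
lemma integral_exp_mul_cos (z : ℝ) :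
    ∫ θ in -Real.pi..Real.pi, Real.exp (z * Real.cos θ) = 2 * Real.pi * besselI0 z := by
  have h1 : HasSum (fun n : ℕ => ∫ θ in -Real.pi..Real.pi, (z * Real.cos θ) ^ n / n !)
      (∫ θ in -Real.pi..Real.pi, Real.exp (z * Real.cos θ)) := by
    refine intervalIntegral.hasSum_integral_of_dominated_convergence
      (fun n _ => |z| ^ n / n !) (fun n => by fun_prop) (fun n => .of_forall fun θ _ => ?_)
      (.of_forall fun θ _ => (NormedSpace.expSeries_div_hasSum_exp |z|).summable) (by simp)
      (.of_forall fun θ _ => ?_)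
    · rw [norm_div, norm_pow, norm_mul, Real.norm_eq_abs, Real.norm_eq_abs, Real.norm_natCast]
      gcongr
      exact mul_le_of_le_one_right (abs_nonneg z) (Real.abs_cos_le_one θ)
    · rw [Real.exp_eq_exp_ℝ]
      exact NormedSpace.expSeries_div_hasSum_exp (z * Real.cos θ)
  have h2 : ∀ n : ℕ, ∫ θ in -Real.pi..Real.pi, (z * Real.cos θ) ^ n / n !
      = z ^ n / n ! * ∫ θ in -Real.pi..Real.pi, Real.cos θ ^ n := fun n => by
    rw [← intervalIntegral.integral_const_mul]
    congr 1 with θ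
    rw [mul_pow]; ring
  simp_rw [h2] at h1
  have hinj : Function.Injective fun k : ℕ => 2 * k := fun a b h => by simpa using h
  -- Odd moments of the cosine vanish, so only even powers remain, and their moments give the Bessel
  -- coefficients.
  rw [← hinj.hasSum_iff] at h1
  · rw [← h1.tsum_eq, besselI0, ← tsum_mul_left]
    refine tsum_congr fun k => ?_
    simp only [Function.comp_apply]
    rw [integral_cos_pow_even_neg_pi_pi, div_pow, pow_mul 2 2 k]
    have : ((2 * k)! : ℝ) ≠ 0 := by positivity
    norm_num
    field_simp
  · intro n hn
    rcases Nat.even_or_odd' n with ⟨k, rfl | rfl⟩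
    · exact absurd ⟨k, rfl⟩ hn
    · rw [integral_cos_pow_odd_neg_pi_pi, mul_zero]

lemma besselI0_nonneg (z : ℝ) : 0 ≤ besselI0 z :=
  tsum_nonneg fun k => div_nonneg (by rw [pow_mul]; positivity) (by positivity)

lemma measurable_besselI0 : Measurable besselI0 :=
  Measurable.tsum fun k => by fun_prop

/-- The measure of the angles whose cosine is at least `c`. -/
lemma volume_setOf_le_cos (c : ℝ) :
    volume {θ | θ ∈ Ioo (-Real.pi) Real.pi ∧ c ≤ Real.cos θ}
      = ENNReal.ofReal (2 * Real.arccos c) := by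
  have habs : ∀ θ ∈ Ioo (-Real.pi) Real.pi, Real.arccos (Real.cos θ) = |θ| := fun θ hθ => by
    rw [← Real.cos_abs, Real.arccos_cos (abs_nonneg θ) (abs_le.2 ⟨hθ.1.le, hθ.2.le⟩)]
  apply le_antisymm
  · calc _ ≤ volume (Icc (-Real.arccos c) (Real.arccos c)) := measure_mono fun θ hθ => by
          have := Real.antitone_arccos hθ.2
          rw [habs θ hθ.1] at this
          exact abs_le.1 this
      _ = _ := by rw [Real.volume_Icc]; congr 1; ring
  · calc _ = volume (Ioo (-Real.arccos c) (Real.arccos c)) := by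
          rw [Real.volume_Ioo]; congr 1; ring
      _ ≤ _ := measure_mono fun θ hθ => by
          have hπ := Real.arccos_le_pi c
          have hm : θ ∈ Ioo (-Real.pi) Real.pi := ⟨by linarith [hθ.1], by linarith [hθ.2]⟩
          refine ⟨hm, le_of_not_ge fun h => ?_⟩
          have := Real.antitone_arccos h
          rw [habs θ hm] at this
          exact absurd (abs_lt.2 hθ) (not_lt.2 this)

lemma measurable_unitStep : Measurable unitStep :=
  Measurable.ite measurableSet_Ici measurable_const measurable_const

lemma unitStep_nonneg (x : ℝ) : 0 ≤ unitStep x := by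
  unfold unitStep; split_ifs <;> simp

namespace ClusterShape

/-- The density of the displacement as a function of its length. -/
noncomputable def radialDensity (c : ClusterShape) (t : ℝ) : ℝ :=
  match c with
  | thomas σ => 1 / (2 * Real.pi * σ ^ 2) * Real.exp (-(t ^ 2 / (2 * σ ^ 2)))
  | matern R => 1 / (Real.pi * R ^ 2) * unitStep (R - t)

lemma density_eq (c : ClusterShape) (u v : Plane) : c.density u v = c.radialDensity ‖u - v‖ := by
  cases c <;> rfl

lemma measurable_radialDensity (c : ClusterShape) : Measurable c.radialDensity := by
  cases c with
  | thomas σ => unfold radialDensity; fun_prop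
  | matern R => exact (measurable_unitStep.comp (measurable_const.sub measurable_id)).const_mul _

lemma radialDensity_nonneg (c : ClusterShape) (t : ℝ) : 0 ≤ c.radialDensity t := by
  cases c with
  | thomas σ => unfold radialDensity; positivity
  | matern R => exact mul_nonneg (by positivity) (unitStep_nonneg _)

lemma measurable_distDensity (c : ClusterShape) (q : ℝ) : Measurable fun g => c.distDensity g q := by
  cases c with
  | thomas σ =>
    unfold distDensity
    exact Measurable.mul (by fun_prop) (measurable_besselI0.comp (by fun_prop))
  | matern R =>
    unfold distDensity
    exact (((Measurable.mul (by fun_prop)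
      (Real.measurable_arccos.comp (by fun_prop))).mul (measurable_unitStep.comp (by fun_prop))).mul
      (measurable_unitStep.comp (by fun_prop))).add
        (Measurable.mul (by fun_prop) (measurable_unitStep.comp (by fun_prop)))

lemma distDensity_nonneg (c : ClusterShape) {g : ℝ} (hg : 0 ≤ g) (q : ℝ) :
    0 ≤ c.distDensity g q := by
  cases c with
  | thomas σ =>
    exact mul_nonneg (by positivity) (besselI0_nonneg _)
  | matern R =>
    exact add_nonneg (mul_nonneg (mul_nonneg (mul_nonneg (by positivity) (Real.arccos_nonneg _))
      (unitStep_nonneg _)) (unitStep_nonneg _)) (mul_nonneg (by positivity) (unitStep_nonneg _))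

/-- Averaging the density of the cluster centred at distance `q` over the circle of radius `r`. -/
lemma lintegral_angle (c : ClusterShape) (hc : 0 < c.scale) {q : ℝ} (hq : 0 < q) :
    ∀ᵐ r : ℝ ∂volume.restrict (Ioi 0), ENNReal.ofReal r * ∫⁻ θ in Ioo (-Real.pi) Real.pi,
        ENNReal.ofReal (c.radialDensity (Real.sqrt (r ^ 2 + q ^ 2 - 2 * r * q * Real.cos θ)))
      = ENNReal.ofReal (c.distDensity r q) := by
  -- By the law of cosines this is a squared distance, (r - q cos θ)² + (q sin θ)².
  have hD : ∀ r θ : ℝ, 0 ≤ r ^ 2 + q ^ 2 - 2 * r * q * Real.cos θ := fun r θ => by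
    nlinarith [sq_nonneg (r - q * Real.cos θ), Real.sin_sq_add_cos_sq θ,
      sq_nonneg (q * Real.sin θ)]
  cases c with
  | thomas σ =>
    have hσ : 0 < σ := hc
    filter_upwards [ae_restrict_mem measurableSet_Ioi] with r hr
    have hr : 0 < r := hr
    have h1 : ∀ θ, (thomas σ).radialDensity
        (Real.sqrt (r ^ 2 + q ^ 2 - 2 * r * q * Real.cos θ))
        = 1 / (2 * Real.pi * σ ^ 2) * Real.exp (-((r ^ 2 + q ^ 2) / (2 * σ ^ 2)))
          * Real.exp (r * q / σ ^ 2 * Real.cos θ) := fun θ => by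
      rw [radialDensity, Real.sq_sqrt (hD r θ), mul_assoc _ (Real.exp _), ← Real.exp_add]
      congr 2
      field_simp
      ring
    simp_rw [h1]
    rw [← ofReal_integral_eq_lintegral_ofReal, integral_const_mul, ← integral_Ioc_eq_integral_Ioo,
      ← intervalIntegral.integral_of_le (by linarith [Real.pi_pos]), integral_exp_mul_cos,
      ← ENNReal.ofReal_mul hr.le]
    · congr 1
      rw [distDensity]
      field_simp
    · have hcont : Continuous fun θ => 1 / (2 * Real.pi * σ ^ 2)
          * Real.exp (-((r ^ 2 + q ^ 2) / (2 * σ ^ 2)))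
          * Real.exp (r * q / σ ^ 2 * Real.cos θ) := by fun_prop
      exact (hcont.integrableOn_Icc (μ := volume)).mono_set Ioo_subset_Icc_self
    · exact .of_forall fun θ => by positivity
  | matern R =>
    have hR : 0 < R := hc
    -- At r = R - q > 0 both terms of the Matérn density are switched on and the formula is twice
    -- the true value; this single radius is discarded as a null set.
    have hne : ∀ᵐ r : ℝ ∂volume.restrict (Ioi 0), r ≠ |R - q| :=
      ae_restrict_of_ae (Measure.ae_ne volume _)
    filter_upwards [ae_restrict_mem measurableSet_Ioi, hne] with r hr hrne
    have hr : 0 < r := hr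
    set c := (r ^ 2 + q ^ 2 - R ^ 2) / (2 * r * q) with hcdef
    have hset : ∀ θ, Real.sqrt (r ^ 2 + q ^ 2 - 2 * r * q * Real.cos θ) ≤ R ↔ c ≤ Real.cos θ := by
      intro θ
      rw [Real.sqrt_le_left hR.le, hcdef, div_le_iff₀ (by positivity)]
      constructor <;> intro h <;> linarith
    have h1 : ∀ θ, ENNReal.ofReal ((matern R).radialDensity
        (Real.sqrt (r ^ 2 + q ^ 2 - 2 * r * q * Real.cos θ)))
        = {θ | c ≤ Real.cos θ}.indicator (fun _ => ENNReal.ofReal (1 / (Real.pi * R ^ 2))) θ := by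
      intro θ
      rw [radialDensity, unitStep]
      by_cases h : c ≤ Real.cos θ
      · rw [if_pos (sub_nonneg.2 ((hset θ).2 h)), mul_one, indicator_of_mem (by exact h)]
      · rw [if_neg fun h' => h ((hset θ).1 (sub_nonneg.1 h')), mul_zero,
          indicator_of_notMem (by exact h), ENNReal.ofReal_zero]
    have hms : MeasurableSet {θ | c ≤ Real.cos θ} :=
      measurableSet_le measurable_const Real.measurable_cos
    simp_rw [h1]
    rw [lintegral_indicator_const hms, Measure.restrict_apply hms,
      show {θ | c ≤ Real.cos θ} ∩ Ioo (-Real.pi) Real.pi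
        = {θ | θ ∈ Ioo (-Real.pi) Real.pi ∧ c ≤ Real.cos θ} from inter_comm _ _,
      volume_setOf_le_cos, ← ENNReal.ofReal_mul (by positivity), ← ENNReal.ofReal_mul hr.le]
    congr 1
    rw [distDensity, ← hcdef]
    have hstep1 : ∀ x : ℝ, 0 ≤ x → unitStep x = 1 := fun x hx => if_pos hx
    have hstep0 : ∀ x : ℝ, x < 0 → unitStep x = 0 := fun x hx => if_neg (not_le.2 hx)
    have hge : (r - q) ^ 2 ≥ R ^ 2 → Real.arccos c = 0 := fun h => by
      rw [Real.arccos_eq_zero, hcdef, one_le_div (by positivity)]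
      nlinarith
    -- If r < |R - q|, the circle of radius r lies inside the cluster disc (q ≤ R, arccosine π) or
    -- misses it (arccosine 0). Otherwise it crosses or touches the boundary for r ≤ R + q and
    -- misses the disc beyond.
    rcases lt_or_gt_of_ne hrne with h | h
    · rw [hstep0 (r - |R - q|) (by linarith)]
      rcases le_total q R with hqR | hqR
      · rw [abs_of_nonneg (by linarith)] at h
        have : Real.arccos c = Real.pi := by
          rw [Real.arccos_eq_pi, hcdef, div_le_iff₀ (by positivity)]
          nlinarith
        rw [this, hstep1 (R - q - r) (by linarith)]
        have := Real.pi_pos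
        field_simp
        ring
      · rw [abs_of_nonpos (by linarith)] at h
        rw [hge (by nlinarith), hstep0 (R - q - r) (by linarith)]
        ring
    · have h' := le_abs_self (R - q)
      rw [hstep0 (R - q - r) (by linarith), hstep1 (r - |R - q|) (by linarith)]
      rcases le_or_gt r (R + q) with h2 | h2
      · rw [hstep1 (R + q - r) (by linarith)]
        ring
      · rw [hstep0 (R + q - r) (by linarith), hge (by nlinarith)]
        ring

end ClusterShape

/-- The rotation of the plane that takes the positive real axis to the ray through `x`. -/
lemma exists_linearIsometryEquiv_complex_plane (x : Plane) :
    ∃ L : ℂ ≃ₗᵢ[ℝ] Plane, L (‖x‖ : ℂ) = x := by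
  let e : ℂ ≃ₗᵢ[ℝ] Plane := Complex.orthonormalBasisOneI.repr
  set w : ℂ := e.symm x
  have hw : ‖w‖ = ‖x‖ := e.symm.norm_map x
  refine ⟨(rotation (Circle.exp w.arg)).trans e, ?_⟩
  rw [LinearIsometryEquiv.trans_apply, rotation_apply, Circle.coe_exp, ← hw, mul_comm,
    Complex.norm_mul_exp_arg_mul_I]
  exact e.apply_symm_apply x

lemma lintegral_complex_polar {F : ℂ → ℝ≥0∞} (hF : Measurable F) :
    ∫⁻ z, F z = ∫⁻ r in Ioi (0 : ℝ), ENNReal.ofReal r * ∫⁻ θ in Ioo (-Real.pi) Real.pi,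
      F (Complex.polarCoord.symm (r, θ)) := by
  have hm : Measurable fun q : ℝ × ℝ => F (Complex.polarCoord.symm q) := by
    simp_rw [Complex.polarCoord_symm_apply]
    exact hF.comp (by fun_prop)
  rw [← Complex.lintegral_comp_polarCoord_symm, polarCoord_target, Measure.volume_eq_prod,
    ← Measure.prod_restrict]
  simp only [smul_eq_mul]
  refine (lintegral_prod _ ((measurable_fst.ennreal_ofReal.mul hm).aemeasurable)).trans ?_
  refine lintegral_congr fun r => ?_
  exact lintegral_const_mul (ENNReal.ofReal r) (hm.comp (measurable_prodMk_left (x := r)))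

lemma norm_polarCoord_symm_sub (r θ q : ℝ) :
    ‖Complex.polarCoord.symm (r, θ) - (q : ℂ)‖
      = Real.sqrt (r ^ 2 + q ^ 2 - 2 * r * q * Real.cos θ) := by
  rw [Complex.norm_def, Complex.normSq_apply, Complex.polarCoord_symm_apply]
  congr 1
  simp [Complex.cos_ofReal_re, Complex.sin_ofReal_re]
  nlinarith [Real.sin_sq_add_cos_sq θ]

lemma lintegral_plane_norm {h : ℝ → ℝ≥0∞} (hh : Measurable h) :
    ∫⁻ x : Plane, h ‖x‖
      = ENNReal.ofReal (2 * Real.pi) * ∫⁻ r in Ioi (0 : ℝ), ENNReal.ofReal r * h r := by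
  have e := Complex.orthonormalBasisOneI.repr
  rw [← (LinearIsometryEquiv.measurePreserving e).lintegral_comp_emb
    e.toHomeomorph.measurableEmbedding]
  simp_rw [LinearIsometryEquiv.norm_map]
  rw [lintegral_complex_polar (F := fun z => h ‖z‖) (hh.comp measurable_norm), ← lintegral_const_mul _ (by fun_prop)]
  refine setLIntegral_congr_fun measurableSet_Ioi fun r hr => ?_
  simp only [Complex.norm_polarCoord_symm, abs_of_pos (mem_Ioi.1 hr)]
  rw [setLIntegral_const, Real.volume_Ioo, show Real.pi - -Real.pi = 2 * Real.pi by ring]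
  ring

namespace ClusterShape

lemma measurable_density_zero (c : ClusterShape) : Measurable fun y : Plane => c.density y 0 := by
  simp_rw [density_eq, sub_zero]
  exact c.measurable_radialDensity.comp measurable_norm

lemma lintegral_offsetLaw (c : ClusterShape) {h : ℝ → ℝ≥0∞} (hh : Measurable h) (x : Plane) :
    ∫⁻ y, h ‖x + y‖ ∂c.offsetLaw
      = ∫⁻ u, ENNReal.ofReal (c.radialDensity ‖u - x‖) * h ‖u‖ := by
  rw [offsetLaw, lintegral_withDensity_eq_lintegral_mul _ c.measurable_density_zero.ennreal_ofReal
      (g := fun y => h ‖x + y‖) (hh.comp (by fun_prop)),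
    ← lintegral_add_left_eq_self (fun u => ENNReal.ofReal (c.radialDensity ‖u - x‖) * h ‖u‖) x]
  simp [density_eq]

/-- The law of the distance from the origin of a user whose cluster centre is `x`. -/
lemma lintegral_norm_add_offsetLaw (c : ClusterShape) (hc : 0 < c.scale) {h : ℝ → ℝ≥0∞}
    (hh : Measurable h) {x : Plane} (hx : x ≠ 0) :
    ∫⁻ y, h ‖x + y‖ ∂c.offsetLaw
      = ∫⁻ g in Ioi (0 : ℝ), ENNReal.ofReal (c.distDensity g ‖x‖) * h g := by
  -- A rotation puts the centre on the positive real axis, where polar coordinates reduce the claim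
  -- to `lintegral_angle`.
  obtain ⟨L, hL⟩ := exists_linearIsometryEquiv_complex_plane x
  have hm : Measurable fun z : ℂ => ENNReal.ofReal (c.radialDensity ‖z - ‖x‖‖) * h ‖z‖ :=
    (c.measurable_radialDensity.comp (by fun_prop)).ennreal_ofReal.mul (hh.comp measurable_norm)
  have h1 : ∀ z, ENNReal.ofReal (c.radialDensity ‖L z - x‖) * h ‖L z‖
      = ENNReal.ofReal (c.radialDensity ‖z - ‖x‖‖) * h ‖z‖ := fun z => by
    rw [L.norm_map]
    nth_rewrite 1 [← hL]
    rw [← map_sub, L.norm_map]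
  rw [c.lintegral_offsetLaw hh, ← (LinearIsometryEquiv.measurePreserving L).lintegral_comp_emb
    L.toHomeomorph.measurableEmbedding]
  simp_rw [h1]
  rw [lintegral_complex_polar hm]
  refine lintegral_congr_ae ?_
  filter_upwards [c.lintegral_angle hc (norm_pos_iff.2 hx), ae_restrict_mem measurableSet_Ioi]
    with r hr hr0
  rw [← hr]
  simp_rw [norm_polarCoord_symm_sub, Complex.norm_polarCoord_symm, abs_of_pos (mem_Ioi.1 hr0)]
  have hmθ : Measurable fun θ => ENNReal.ofReal
      (c.radialDensity (Real.sqrt (r ^ 2 + ‖x‖ ^ 2 - 2 * r * ‖x‖ * Real.cos θ))) :=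
    (c.measurable_radialDensity.comp (by fun_prop)).ennreal_ofReal
  rw [lintegral_mul_const _ hmθ, ← mul_assoc]

end ClusterShape

/-! ### Continuity and radial form of the one-user Laplace transform. -/

/-- The convolution of a bounded function and an integrable function is continuous. -/
lemma continuous_integral_mul_sub {h f : Plane → ℝ} (hm : Measurable h) (hb : ∀ t, |h t| ≤ 1)
    (hf : Integrable f) : Continuous fun x => ∫ t, h t * f (x - t) := by
  have hint : ∀ {g : Plane → ℝ}, Integrable g → ∀ x, Integrable fun t => h t * g (x - t) :=
    fun {g} hg x => (hg.comp_sub_left x).bdd_mul hm.aestronglyMeasurable (.of_forall hb)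
  refine continuous_of_uniform_approx_of_continuous fun u hu => ?_
  obtain ⟨ε, hε, hεu⟩ := Metric.mem_uniformity_dist.1 hu
  -- Convolution with a continuous compactly supported g is continuous, and it differs from the
  -- convolution with f by at most the L¹ distance of f and g, uniformly in x.
  obtain ⟨g, hgc, hgε, hg, hgi⟩ := hf.exists_hasCompactSupport_integral_sub_le (half_pos hε)
  refine ⟨fun x => ∫ t, h t * g (x - t), ?_, fun x => hεu ?_⟩
  · have hloc : LocallyIntegrable h :=
      (locallyIntegrable_const (1 : ℝ)).mono hm.aestronglyMeasurable
        (.of_forall fun t => by simpa using hb t)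
    exact hgc.continuous_convolution_right (ContinuousLinearMap.mul ℝ ℝ) hloc hg
  · rw [dist_eq_norm, ← integral_sub (hint hf x) (hint hgi x)]
    refine (norm_integral_le_integral_norm _).trans_lt ?_
    have h1 : ∫ t, ‖h t * f (x - t) - h t * g (x - t)‖ ≤ ∫ t, ‖f (x - t) - g (x - t)‖ := by
      refine integral_mono ((hint hf x).sub (hint hgi x)).norm
        ((hf.comp_sub_left x).sub (hgi.comp_sub_left x)).norm fun t => ?_
      simp only
      rw [← mul_sub, norm_mul]
      exact mul_le_of_le_one_left (norm_nonneg _) (hb t)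
    rw [integral_sub_left_eq_self (fun t => ‖f t - g t‖) volume x] at h1
    linarith

namespace UplinkParams

variable {p : UplinkParams} (hp : p.Admissible)
include hp

lemma rootβ_pos : 0 < p.rootβ := Real.sqrt_pos.2 (mul_pos hp.βa_pos hp.βb_pos)

lemma Oe_eq_integral {s q : ℝ}
    (hi : IntegrableOn (fun g => p.linkLaplace s g * p.shape.distDensity g q) (Ioi 0)) :
    p.Oe s q = ∫ g in Ioi (0 : ℝ), p.linkLaplace s g * p.shape.distDensity g q := by
  have hβ := rootβ_pos hp
  have hlt : ∀ n : ℕ, (n : ℝ) / p.rootβ ≤ ((n : ℝ) + 1) / p.rootβ := fun n => by gcongr; linarith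
  -- These half-open intervals are the level sets of γ on [0, ∞), so the series over γ₁ is one
  -- integral over the half line.
  have hmem : ∀ (n : ℕ) (g : ℝ), g ∈ Ico ((n : ℝ) / p.rootβ) (((n : ℝ) + 1) / p.rootβ) ↔
      0 ≤ g ∧ p.γ g = n := fun n g => by
    rw [mem_Ico, div_le_iff₀ hβ, lt_div_iff₀ hβ, γ]
    constructor
    · intro h
      have h0 : 0 ≤ g * p.rootβ := (Nat.cast_nonneg n).trans h.1
      exact ⟨nonneg_of_mul_nonneg_left h0 hβ, (Nat.floor_eq_iff h0).2 h⟩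
    · rintro ⟨h0, h1⟩
      exact (Nat.floor_eq_iff (mul_nonneg h0 hβ.le)).1 h1
  have hU : ⋃ n : ℕ, Ico ((n : ℝ) / p.rootβ) (((n : ℝ) + 1) / p.rootβ) = Ici 0 := by
    ext g
    simp only [mem_iUnion, hmem, mem_Ici]
    exact ⟨fun ⟨_, h, _⟩ => h, fun h => ⟨_, h, rfl⟩⟩
  have hs := hasSum_integral_iUnion (μ := volume)
    (s := fun n : ℕ => Ico ((n : ℝ) / p.rootβ) (((n : ℝ) + 1) / p.rootβ))
    (f := fun g => p.linkLaplace s g * p.shape.distDensity g q) (fun n => measurableSet_Ico)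
    (fun m n hmn => disjoint_left.2 fun g hg hg' =>
      hmn ((((hmem m g).1 hg).2).symm.trans ((hmem n g).1 hg').2))
    (by rw [hU]; exact (integrableOn_Ici_iff_integrableOn_Ioi enorm_ne_top).2 hi)
  rw [hU, integral_Ici_eq_integral_Ioi] at hs
  rw [← hs.tsum_eq, Oe]
  refine tsum_congr fun n => ?_
  rw [intervalIntegral.integral_of_le (hlt n), ← integral_Ico_eq_integral_Ioc]
  refine setIntegral_congr_fun measurableSet_Ico fun g hg => ?_
  simp only [linkLaplace, ((hmem n g).1 hg).2]

/-- The normalization of the cluster density is not computed: the product measure has mass 1, and so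
does its channel factor. -/
lemma isProbabilityMeasure_offsetLaw (hu : IsProbabilityMeasure p.userLaw) :
    IsProbabilityMeasure p.shape.offsetLaw := by
  have := isProbabilityMeasure_channelLaw hp
  have h : p.userLaw = p.shape.offsetLaw.prod p.channelLaw := by rw [userLaw, channelLaw]
  constructor
  have h1 := hu.measure_univ
  rwa [h, ← univ_prod_univ, Measure.prod_prod, measure_univ (μ := p.channelLaw), mul_one] at h1

lemma integrable_radialDensity (hu : IsProbabilityMeasure p.userLaw) :
    Integrable fun y : Plane => p.shape.radialDensity ‖y‖ := by
  have := isProbabilityMeasure_offsetLaw hp hu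
  refine ⟨(p.shape.measurable_radialDensity.comp measurable_norm).aestronglyMeasurable, ?_⟩
  rw [hasFiniteIntegral_iff_ofReal (.of_forall fun y => p.shape.radialDensity_nonneg _)]
  have h := p.shape.lintegral_offsetLaw (h := fun _ => 1) measurable_const 0
  simp only [sub_zero, mul_one, lintegral_one, measure_univ] at h
  rw [← h]
  exact ENNReal.one_lt_top

lemma abs_linkLaplace_le_one {s : ℝ} (hs : 0 ≤ s) (r : ℝ) : |p.linkLaplace s r| ≤ 1 := by
  rw [abs_of_nonneg (linkLaplace_nonneg hp hs r)]
  simpa using ofReal_linkLaplace_le_one hp hs r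

lemma toReal_userLaplace_eq {s : ℝ} (hs : 0 ≤ s) (x : Plane) :
    (p.userLaplace s x).toReal
      = ∫ t : Plane, p.linkLaplace s ‖t‖ * p.shape.radialDensity ‖x - t‖ := by
  have hm : Measurable fun t : Plane => p.linkLaplace s ‖t‖ * p.shape.radialDensity ‖x - t‖ :=
    ((measurable_linkLaplace s).comp measurable_norm).mul
      (p.shape.measurable_radialDensity.comp (by fun_prop))
  rw [integral_eq_lintegral_of_nonneg_ae (.of_forall fun t =>
      mul_nonneg (linkLaplace_nonneg hp hs _) (p.shape.radialDensity_nonneg _))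
    hm.aestronglyMeasurable, userLaplace_eq_lintegral_offsetLaw hp hs,
    p.shape.lintegral_offsetLaw (h := fun r => ENNReal.ofReal (p.linkLaplace s r))
      (measurable_linkLaplace s).ennreal_ofReal]
  congr 1
  refine lintegral_congr fun t => ?_
  rw [ENNReal.ofReal_mul (linkLaplace_nonneg hp hs _), norm_sub_rev, mul_comm]

lemma continuous_toReal_userLaplace (hu : IsProbabilityMeasure p.userLaw) {s : ℝ} (hs : 0 ≤ s) :
    Continuous fun x => (p.userLaplace s x).toReal := by
  simp_rw [toReal_userLaplace_eq hp hs]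
  exact continuous_integral_mul_sub (h := fun t => p.linkLaplace s ‖t‖)
    (f := fun y => p.shape.radialDensity ‖y‖)
    ((measurable_linkLaplace s).comp measurable_norm)
    (fun t => abs_linkLaplace_le_one hp hs _) (integrable_radialDensity hp hu)

omit hp in
lemma userLaplace_le_one (hu : IsProbabilityMeasure p.userLaw) (s : ℝ) (x : Plane) :
    p.userLaplace s x ≤ 1 :=
  (lintegral_mono (g := fun _ => 1) fun _ => eNeg_le_one _).trans_eq (by simp)

-- The gain is finite, so its exponential is everywhere positive. This makes -log G(z(x)) finite.
omit hp in
lemma userLaplace_ne_zero (hu : IsProbabilityMeasure p.userLaw) (s : ℝ) (x : Plane) :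
    p.userLaplace s x ≠ 0 := by
  have hm : Measurable fun m => eNeg (ENNReal.ofReal s * ENNReal.ofReal (p.markGain x m)) := by
    have := p.measurable_markGain.comp (measurable_prodMk_left (x := x))
    exact measurable_eNeg.comp (this.ennreal_ofReal.const_mul _)
  rw [userLaplace, Ne, lintegral_eq_zero_iff hm]
  intro h
  obtain ⟨m, h0⟩ := h.exists
  exact eNeg_ne_zero (ENNReal.mul_ne_top ENNReal.ofReal_ne_top ENNReal.ofReal_ne_top) h0

/-- `O_e(s, ‖x‖)` is the Laplace transform of the channel gain of a user of the cluster at `x`. -/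
lemma toReal_userLaplace_eq_Oe (hu : IsProbabilityMeasure p.userLaw) {s : ℝ} (hs : 0 ≤ s)
    {x : Plane} (hx : x ≠ 0) : (p.userLaplace s x).toReal = p.Oe s ‖x‖ := by
  have hm : Measurable fun g => p.linkLaplace s g * p.shape.distDensity g ‖x‖ :=
    (measurable_linkLaplace s).mul (p.shape.measurable_distDensity _)
  have hnn : ∀ᵐ g ∂volume.restrict (Ioi (0 : ℝ)),
      0 ≤ p.linkLaplace s g * p.shape.distDensity g ‖x‖ := by
    filter_upwards [ae_restrict_mem measurableSet_Ioi] with g hg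
    exact mul_nonneg (linkLaplace_nonneg hp hs g) (p.shape.distDensity_nonneg (le_of_lt hg) _)
  have h : p.userLaplace s x = ∫⁻ g in Ioi (0 : ℝ),
      ENNReal.ofReal (p.linkLaplace s g * p.shape.distDensity g ‖x‖) := by
    rw [userLaplace_eq_lintegral_offsetLaw hp hs, p.shape.lintegral_norm_add_offsetLaw hp.scale_pos
      (h := fun r => ENNReal.ofReal (p.linkLaplace s r))
      (measurable_linkLaplace s).ennreal_ofReal hx]
    refine lintegral_congr fun g => ?_
    rw [ENNReal.ofReal_mul (linkLaplace_nonneg hp hs _), mul_comm]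
  rw [Oe_eq_integral hp, integral_eq_lintegral_of_nonneg_ae hnn hm.aestronglyMeasurable, h]
  refine ⟨hm.aestronglyMeasurable, ?_⟩
  -- Integrability comes from the probabilistic meaning: the integral is a Laplace transform, hence
  -- at most 1.
  rw [hasFiniteIntegral_iff_ofReal hnn, ← h]
  exact (userLaplace_le_one hu s x).trans_lt ENNReal.one_lt_top

end UplinkParams

/-! ### Assembly for a general generating function. -/

namespace UplinkNetwork

variable {p : UplinkParams} {Ω₀ Ω : Type*} [MeasurableSpace Ω₀] [MeasurableSpace Ω]
  {Φ : ℕ → Ω₀ → Plane} {P₀ : Measure Ω₀} {sizeLaw : Measure ℕ} {P : Measure Ω}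

/-- The Laplace transform of the inter-cluster interference, for cluster sizes of probability
generating function `G`. -/
theorem laplaceInter_eq_of_generating_function [IsProbabilityMeasure P₀] [IsProbabilityMeasure P]
    (N : UplinkNetwork p Φ P₀ sizeLaw P) (hp : p.Admissible) (hΦ : IsHomogeneousPPP p.lam Φ P₀)
    {s : ℝ} (hs : 0 ≤ s) {G : ℝ → ℝ} (hG : Continuous G)
    (hGpos : ∀ z, 0 < z → 0 < G z) (hGle : ∀ z, 0 ≤ z → z ≤ 1 → G z ≤ 1)
    (hsize : ∀ z, 0 ≤ z → ∫⁻ k, ENNReal.ofReal z ^ k ∂sizeLaw = ENNReal.ofReal (G z)) :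
    N.laplaceInter s = expNeg (ENNReal.ofReal (2 * Real.pi * p.lam) *
      ∫⁻ q in Ioi (0 : ℝ), ENNReal.ofReal ((1 - G (p.Oe s q)) * q)) := by
  have hu : IsProbabilityMeasure p.userLaw :=
    (N.user_law 0 0).map_eq ▸ Measure.isProbabilityMeasure_map (N.user_law 0 0).aemeasurable
  set z : Plane → ℝ := fun x => (p.userLaplace s x).toReal with hz
  have hzc : Continuous z := UplinkParams.continuous_toReal_userLaplace hp hu hs
  have hle : ∀ x, p.userLaplace s x ≤ 1 := UplinkParams.userLaplace_le_one hu s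
  have hz0 : ∀ x, 0 < z x := fun x => ENNReal.toReal_pos
    (UplinkParams.userLaplace_ne_zero hu s x) ((hle x).trans_lt ENNReal.one_lt_top).ne
  have hz1 : ∀ x, z x ≤ 1 := fun x => by
    simpa using ENNReal.toReal_mono ENNReal.one_ne_top (hle x)
  have hGz0 : ∀ x, 0 < G (z x) := fun x => hGpos _ (hz0 x)
  have hGz1 : ∀ x, G (z x) ≤ 1 := fun x => hGle _ (hz0 x).le (hz1 x)
  -- Chosen so that e^{-w(x)} = G(z(x)), the mean factor of a cluster at x.
  set w : Plane → ℝ≥0 := fun x => Real.toNNReal (-Real.log (G (z x))) with hw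
  have hwc : Continuous w := continuous_real_toNNReal.comp
    ((hG.comp hzc).log fun x => (hGz0 x).ne').neg
  have hew : ∀ x, eNeg (w x) = ENNReal.ofReal (G (z x)) := fun x => by
    change eNeg (ENNReal.ofReal (-Real.log (G (z x)))) = _
    rw [eNeg_ofReal (neg_nonneg.2 (Real.log_nonpos (hGz0 x).le (hGz1 x))), neg_neg,
      Real.exp_log (hGz0 x)]
  have hws : ∀ x, ∫⁻ k, p.userLaplace s x ^ k ∂sizeLaw = eNeg (w x) := fun x => by
    rw [hew, ← hsize _ (hz0 x).le, hz,
      ENNReal.ofReal_toReal ((hle x).trans_lt ENNReal.one_lt_top).ne]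
  rw [N.laplaceInter_eq, N.lintegral_eNeg_interInterference s hwc.measurable hws,
    N.palm.reduced_laplace hΦ hp.lam_pos hwc, toReal_eNeg]
  congr 1
  -- Evaluating z on a fixed ray gives a function of ‖y‖ that is measurable by continuity of z, so
  -- measurability of O_e in q is not required. The origin, where z is not identified with O_e, is a
  -- null set.
  have hrad : ∫⁻ y, (1 - eNeg (w y)) = ∫⁻ y : Plane,
      ENNReal.ofReal (1 - G (z (EuclideanSpace.single 0 ‖y‖))) := by
    refine lintegral_congr_ae ?_
    filter_upwards [Measure.ae_ne volume (0 : Plane)] with y hy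
    have hy' : (EuclideanSpace.single 0 ‖y‖ : Plane) ≠ 0 := by
      rw [← norm_ne_zero_iff]; simpa using hy
    have h1 : z (EuclideanSpace.single 0 ‖y‖) = z y := by
      rw [hz]
      simp only
      rw [UplinkParams.toReal_userLaplace_eq_Oe hp hu hs hy,
        UplinkParams.toReal_userLaplace_eq_Oe hp hu hs hy']
      simp
    rw [h1, hew, ← ENNReal.ofReal_one, ENNReal.ofReal_sub _ (hGz0 y).le]
  have hmr : Measurable fun r : ℝ =>
      ENNReal.ofReal (1 - G (z (EuclideanSpace.single 0 r : Plane))) := by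
    have hs : Continuous fun r : ℝ => (EuclideanSpace.single 0 r : Plane) :=
      (PiLp.continuous_toLp 2 fun _ : Fin 2 => ℝ).comp
        (continuous_single (A := fun _ : Fin 2 => ℝ) 0)
    exact (continuous_const.sub (hG.comp (hzc.comp hs))).measurable.ennreal_ofReal
  rw [hrad, lintegral_plane_norm hmr, ← mul_assoc, ← ENNReal.ofReal_mul hp.lam_pos.le,
    mul_comm p.lam]
  congr 1
  refine setLIntegral_congr_fun measurableSet_Ioi fun r hr => ?_
  have hr : 0 < r := hr
  have hr' : (EuclideanSpace.single 0 r : Plane) ≠ 0 := by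
    rw [← norm_ne_zero_iff]; simpa using hr.ne'
  have h1 : z (EuclideanSpace.single 0 r) = p.Oe s r := by
    rw [hz]
    simp only
    rw [UplinkParams.toReal_userLaplace_eq_Oe hp hu hs hr']
    simp [abs_of_pos hr]
  rw [h1, ← ENNReal.ofReal_mul hr.le, mul_comm]

end UplinkNetwork

theorem lemma3 {Ω₀ Ω : Type*} [MeasurableSpace Ω₀] [MeasurableSpace Ω]
    (P₀ : Measure Ω₀) [IsProbabilityMeasure P₀] (P : Measure Ω) [IsProbabilityMeasure P]
    (p : UplinkParams) (hp : p.Admissible)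
    (Φ : ℕ → Ω₀ → Plane) (hΦ : IsHomogeneousPPP p.lam Φ P₀)
    (Nbar : ℕ) (nbar : ℝ≥0) (s : ℝ) (hs : 0 ≤ s) :
    (∀ N : UplinkNetwork p Φ P₀ (Measure.dirac Nbar) P,
      N.laplaceInter s =
        expNeg (ENNReal.ofReal (2 * Real.pi * p.lam) *
          ∫⁻ q in Ioi (0 : ℝ), ENNReal.ofReal ((1 - p.Oe s q ^ Nbar) * q))) ∧
    (∀ N : UplinkNetwork p Φ P₀ (poissonMeasure nbar) P,
      N.laplaceInter s =
        expNeg (ENNReal.ofReal (2 * Real.pi * p.lam) *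
          ∫⁻ q in Ioi (0 : ℝ),
            ENNReal.ofReal ((1 - Real.exp (-((nbar : ℝ) * (1 - p.Oe s q)))) * q))) := by
  refine ⟨fun N => ?_, fun N => ?_⟩
  · refine N.laplaceInter_eq_of_generating_function hp hΦ hs (G := fun z => z ^ Nbar)
      (by fun_prop) (fun z hz => pow_pos hz _) (fun z h0 h1 => pow_le_one₀ h0 h1)
      fun z hz => ?_
    rw [lintegral_dirac, ENNReal.ofReal_pow hz]
  · refine N.laplaceInter_eq_of_generating_function hp hΦ hs
      (G := fun z => Real.exp (-((nbar : ℝ) * (1 - z)))) (by fun_prop)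
      (fun z _ => Real.exp_pos _) (fun z _ h1 => ?_)
      fun z hz => lintegral_pow_poissonMeasure nbar hz
    rw [Real.exp_le_one_iff]
    exact neg_nonpos.2 (mul_nonneg nbar.2 (by linarith))
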